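/- **Theorem.** Let $n,l\in\mathbb N$, $\frac{nl}{2}<s\le nl$, $0<q<\infty$, $\max\{q,\frac{nl}{s}\}\le p_1,\dots,p_l<\infty$ and $\frac1p=\frac1{p_1}+\cdots+\frac1{p_l}$. *Notation.* $\widehat f(\xi)=\int f(x)e^{-2\pi i\langle x,\xi\rangle}\,dx$. Let $\Psi$ be a Schwartz function on $(\mathbb R^n)^l$ with $\operatorname{supp}\widehat\Psi\subset\{\frac12\le|\vec\xi|\le2\}$ and $\sum_{j\in\mathbb Z}\widehat\Psi(2^j\vec\xi)=1$ for $\vec\xi\ne\vec 0$, and let $\|f\|_{L^2_s(\mathbb R^{nl})}=\big(\int_{\mathbb R^{nl}}(1+4\pi^2|\xi|^2)^s|\widehat f(\xi)|^2\,d\xi\big)^{1/2}$. For $\sigma:(\mathbb R^n)^l\to\mathbb C$ and Schwartz functions $f_1,\dots,f_l$ on $\mathbb R^n$ put $$T_\sigma(f_1,\dots,f_l)(x)=\int_{(\mathbb R^n)^l}\sigma(\xi_1,\dots,\xi_l)\Big(\prod_{j=1}^l\widehat{f_j}(\xi_j)\Big)e^{2\pi i\langle x,\xi_1+\cdots+\xi_l\rangle}\,d\xi_1\cdots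 d\xi_l .$$ A weight is a locally integrable function $w:\mathbb R^n\to[0,\infty)$ that is positive almost everywhere, and $\|f\|_{L^r(w)}=(\int|f|^rw\,dx)^{1/r}$. For exponents $1\le r_1,\dots,r_l<\infty$ with $\frac1r=\frac1{r_1}+\cdots+\frac1{r_l}$, an $l$-tuple of weights $\vec w=(w_1,\dots,w_l)$ belongs to $A_{(r_1,\dots,r_l)}$ if $$\sup_Q\Big(\frac1{|Q|}\int_Q\prod_{j=1}^l w_j^{r/r_j}\,dx\Big)^{1/r}\prod_{j=1}^l\Big(\frac1{|Q|}\int_Qw_j^{1-r_j'}\,dx\Big)^{1/r_j'}<\infty ,$$ where $Q$ runs over the cubes with sides parallel to the axes, $r_j'=\frac{r_j}{r_j-1}$, and the $j$-th factor is read as $(\operatorname{ess\,inf}_Qw_j)^{-1}$ if $r_j=1$. Let $v_{\vec w}=\prod_{j=1}^lw_j^{p/p_j}$. *Statement.* Suppose that for every $\sigma:(\mathbb R^n)^l\to\mathbb C$ with $\sup_{k\in\mathbb Z}\|\sigma(2^k\cdot)\widehat\Psi\|_{L^2_s(\mathbb R^{nl})}<\infty$ and every $\vec w\in A_{(p_1/q,\dots,p_l/q)}$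 there is a finite constant $C$ (which may depend on $\vec w$ and on $\sigma$) such that $$\|T_\sigma(f_1,\dots,f_l)\|_{L^p(v_{\vec w})}\le C\,\sup_{k\in\mathbb Z}\|\sigma(2^k\cdot)\widehat\Psi\|_{L^2_s(\mathbb R^{nl})}\prod_{j=1}^l\|f_j\|_{L^{p_j}(w_j)}$$ for all Schwartz functions $f_1,\dots,f_l$ on $\mathbb R^n$. Then $q\ge\frac{nl}{s}$. -/

import Mathlib

open MeasureTheory FourierTransform SchwartzMap
open scoped ENNReal NNReal

noncomputable section

/-- `ℝⁿ` with its Euclidean norm. -/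
abbrev Rn (n : ℕ) : Type := EuclideanSpace ℝ (Fin n)

/-- `(ℝⁿ)ˡ`, that is `ℝⁿˡ`, with its Euclidean norm; `ξ j` is the `j`-th block of `ξ`. -/
abbrev RnPow (n l : ℕ) : Type := PiLp 2 (fun _ : Fin l => Rn n)

/-- The closed cube with sides of length `r` parallel to the axes and lower corner `a`. -/
def cube {n : ℕ} (a : Rn n) (r : ℝ) : Set (Rn n) :=
  {x | ∀ i, x i ∈ Set.Icc (a i) (a i + r)}

/-- The exponent `p` with `1 / p = 1 / p₁ + ⋯ + 1 / pₗ`. -/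
def jointExponent {l : ℕ} (P : Fin l → ℝ) : ℝ := (∑ j, 1 / P j)⁻¹

/-- The combined weight `v_w = ∏ⱼ wⱼ ^ (p / pⱼ)`. -/
def jointWeight {n l : ℕ} (P : Fin l → ℝ) (w : Fin l → Rn n → ℝ≥0) (x : Rn n) : ℝ≥0 :=
  ∏ j, w j x ^ (jointExponent P / P j)

/-- The factor of the weight `u` with exponent `t ≥ 1` on the cube `Q` in the multiple weight
condition: `(|Q|⁻¹ ∫_Q u ^ (1 - t')) ^ (1 / t')`, read as `(ess inf_Q u)⁻¹` if `t = 1`. -/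
def dualFactor {n : ℕ} (t : ℝ) (u : Rn n → ℝ≥0) (Q : Set (Rn n)) : ℝ≥0∞ :=
  if t = 1 then (essInf (fun x => (u x : ℝ≥0∞)) (volume.restrict Q))⁻¹
  else (⨍⁻ x in Q, (u x : ℝ≥0∞) ^ (1 - t.conjExponent) ∂volume) ^ (1 / t.conjExponent)

/-- The constant `[w]_{A_P}` of a tuple of weights, a supremum over all cubes. -/
def multiWeightConst {n l : ℕ} (P : Fin l → ℝ) (w : Fin l → Rn n → ℝ≥0) : ℝ≥0∞ :=
  ⨆ (a : Rn n) (r : ℝ) (_ : 0 < r),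
    (⨍⁻ x in cube a r, (jointWeight P w x : ℝ≥0∞) ∂volume) ^ (1 / jointExponent P) *
      ∏ j, dualFactor (P j) (w j) (cube a r)

/-- The class `A_P` of Lerner, Ombrosi, Pérez, Torres and Trujillo-González: tuples of weights,
i.e. of locally integrable functions `ℝⁿ → [0, ∞)` that are positive almost everywhere,
with finite constant. -/
structure IsMultiWeight {n l : ℕ} (P : Fin l → ℝ) (w : Fin l → Rn n → ℝ≥0) : Prop where
  locallyIntegrable : ∀ j, LocallyIntegrable (fun x => (w j x : ℝ)) volume
  pos : ∀ j, ∀ᵐ x, 0 < w j x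
  const_lt_top : multiWeightConst P w < ⊤

/-- `‖f‖_{L^p(w)} = (∫ |f|^p w) ^ (1 / p)`, for `0 < p < ∞`. -/
def weightedNorm {n : ℕ} (p : ℝ) (w : Rn n → ℝ≥0) (f : Rn n → ℂ) : ℝ≥0∞ :=
  (∫⁻ x, ‖f x‖ₑ ^ p * (w x : ℝ≥0∞)) ^ (1 / p)

open scoped Classical in
/-- The Sobolev norm `‖f‖_{L²_s} = (∫ (1 + 4π²|ξ|²)^s |𝓕 f(ξ)|² dξ) ^ (1 / 2)` for `s ≥ 0`, where
`𝓕` is the Fourier transform of `L²`; it is infinite if `f` is not in `L²`. -/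
def sobolevNorm {n l : ℕ} (s : ℝ) (f : RnPow n l → ℂ) : ℝ≥0∞ :=
  if h : MemLp f 2 volume then
    (∫⁻ ξ, ENNReal.ofReal ((1 + 4 * Real.pi ^ 2 * ‖ξ‖ ^ 2) ^ s) *
      ‖(𝓕 (h.toLp f) : Lp ℂ 2 (volume : Measure (RnPow n l))) ξ‖ₑ ^ 2) ^ (1 / 2 : ℝ)
  else ⊤

/-- `Ψ` generates a homogeneous Littlewood-Paley partition of unity on `(ℝⁿ)ˡ`: its Fourier
transform is supported in `1/2 ≤ |ξ| ≤ 2`, and its dyadic dilates sum to `1` off the origin. -/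
structure IsLittlewoodPaley {n l : ℕ} (Ψ : 𝓢(RnPow n l, ℂ)) : Prop where
  support_subset : tsupport (𝓕 Ψ : 𝓢(RnPow n l, ℂ)) ⊆ {ξ | 1 / 2 ≤ ‖ξ‖ ∧ ‖ξ‖ ≤ 2}
  hasSum_one : ∀ ξ : RnPow n l, ξ ≠ 0 →
    HasSum (fun j : ℤ => (𝓕 Ψ : 𝓢(RnPow n l, ℂ)) ((2 : ℝ) ^ j • ξ)) 1

/-- `sup_k ‖σ(2ᵏ ·) 𝓕Ψ‖_{L²_s}`, over all integers `k`. -/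
def hormanderNorm {n l : ℕ} (Ψ : 𝓢(RnPow n l, ℂ)) (s : ℝ) (σ : RnPow n l → ℂ) : ℝ≥0∞ :=
  ⨆ k : ℤ, sobolevNorm s
    (fun ξ => σ ((2 : ℝ) ^ k • ξ) * (𝓕 Ψ : 𝓢(RnPow n l, ℂ)) ξ)

/-- The multilinear Fourier multiplier operator with symbol `σ`, on Schwartz functions:
`T_σ(f₁, …, fₗ)(x) = ∫ σ(ξ) (∏ⱼ 𝓕fⱼ(ξⱼ)) e^{2πi⟨x, ξ₁ + ⋯ + ξₗ⟩} dξ`. -/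
def multiplierOp {n l : ℕ} (σ : RnPow n l → ℂ) (f : Fin l → 𝓢(Rn n, ℂ)) (x : Rn n) : ℂ :=
  ∫ ξ : RnPow n l, σ ξ * (∏ j, (𝓕 (f j) : 𝓢(Rn n, ℂ)) (ξ j)) *
    Complex.exp (2 * Real.pi * Complex.I * (inner ℝ x (∑ j, ξ j) : ℝ))

end

/-! Suppose `q < nl/s`. A symbol with `s` derivatives in `L²` at each dyadic scale may be as large
as `|ξ|^{-s}` at high frequency and still oscillate like `e^{2πi⟨ē, ξ⟩}`, where `ē = (e, …, e)` and
`|e| = 1`: at scale `2ᵏ` the modulation costs `2^{ks}` in `L²_s`, exactly what the decay gives back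
(`hormanderNorm_oscillatingSymbol_lt_top`). The oscillation translates the output by a unit
distance, so weights that are small near `e` and large near `0` can detect it.

Take `wⱼ = |x|^{-α} |x - e|^{α(Pⱼ/q - 1)}` with `sq/l < α < n`. This has the form `u v^{1 - Tⱼ}`
with `u`, `v` in `A₁` and `Tⱼ = Pⱼ/q`, as in Jones factorization, so the tuple is admissible
(`isMultiWeight_twoPowerWeight`). Test on bumps at `e` of width `1/N` and frequency about `N`. The
weights make the product of the input norms at most a constant times `N^{nl - n/p + α/p - αl/q}`
(`exists_lintegral_dilation_le`). The output has size at least a constant times `N^{nl - s}` on a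
ball of radius comparable to `1/N` about `0` (`multiplierOp_oscillatingSymbol_eq`,
`exists_le_norm_diagonal_integral_bump`), and its norm is at least a constant times `N^{nl - s - n/p
+ α/p}` (`exists_le_lintegral_twoPowerWeight`). The quotient grows like `N^{αl/q - s}`, whose
exponent is positive, so no finite constant works. -/

/-! ### Sobolev norms of Schwartz functions and of their modulations -/

/-- Polynomial decay of a Schwartz function, of arbitrary order. -/
lemma SchwartzMap.exists_norm_le_one_add_rpow {E : Type*} [NormedAddCommGroup E] [NormedSpace ℝ E]
    (f : 𝓢(E, ℂ)) (r : ℝ) : ∃ C : ℝ, 0 < C ∧ ∀ x, ‖f x‖ ≤ C * (1 + ‖x‖) ^ (-r) := by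
  obtain ⟨k, hk⟩ := exists_nat_ge r
  set C := 2 ^ k * ((Finset.Iic (k, 0)).sup fun m => SchwartzMap.seminorm ℝ m.1 m.2) f with hC
  have hC0 : 0 ≤ C := by positivity
  refine ⟨C + 1, by positivity, fun x => ?_⟩
  have h := SchwartzMap.one_add_le_sup_seminorm_apply (𝕜 := ℝ) (m := (k, 0)) le_rfl le_rfl f x
  rw [norm_iteratedFDeriv_zero] at h
  have h1 : (1 : ℝ) ≤ 1 + ‖x‖ := by linarith [norm_nonneg x]
  have h2 : (1 + ‖x‖) ^ r ≤ (1 + ‖x‖) ^ k := by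
    rw [← Real.rpow_natCast]; exact Real.rpow_le_rpow_of_exponent_le h1 hk
  rw [Real.rpow_neg (by linarith), ← div_eq_mul_inv, le_div_iff₀ (by positivity)]
  calc ‖f x‖ * (1 + ‖x‖) ^ r ≤ ‖f x‖ * (1 + ‖x‖) ^ k := by gcongr
    _ = (1 + ‖x‖) ^ k * ‖f x‖ := mul_comm _ _
    _ ≤ C := h
    _ ≤ C + 1 := by linarith

lemma lintegral_sobolev_lt_top {E : Type*} [NormedAddCommGroup E] [InnerProductSpace ℝ E]
    [FiniteDimensional ℝ E] [MeasurableSpace E] [BorelSpace E] (f : 𝓢(E, ℂ)) {s : ℝ} (hs : 0 ≤ s) :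
    ∫⁻ ξ, ENNReal.ofReal ((1 + 4 * Real.pi ^ 2 * ‖ξ‖ ^ 2) ^ s) * ‖f ξ‖ₑ ^ 2 < ⊤ := by
  set d : ℝ := (Module.finrank ℝ E : ℝ) with hd
  obtain ⟨C, hC, hf⟩ := f.exists_norm_le_one_add_rpow (s + d + 1)
  have hd0 : 0 ≤ d := by positivity
  have key : ∀ ξ : E, ENNReal.ofReal ((1 + 4 * Real.pi ^ 2 * ‖ξ‖ ^ 2) ^ s) * ‖f ξ‖ₑ ^ 2 ≤
      ENNReal.ofReal ((4 * Real.pi ^ 2) ^ s * C ^ 2) *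
        ENNReal.ofReal ((1 + ‖ξ‖) ^ (-(d + 1))) := by
    intro ξ
    rw [← ofReal_norm, ← ENNReal.ofReal_pow (norm_nonneg _),
      ← ENNReal.ofReal_mul (by positivity), ← ENNReal.ofReal_mul (by positivity)]
    refine ENNReal.ofReal_le_ofReal ?_
    have h1 : (1 : ℝ) ≤ 1 + ‖ξ‖ := by linarith [norm_nonneg ξ]
    have hpi : 1 ≤ 4 * Real.pi ^ 2 := by nlinarith [Real.pi_gt_three]
    have h2 : (1 + 4 * Real.pi ^ 2 * ‖ξ‖ ^ 2) ^ s ≤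
        (4 * Real.pi ^ 2) ^ s * (1 + ‖ξ‖) ^ (2 * s) := by
      rw [Real.rpow_mul (by positivity), Real.rpow_two, ← Real.mul_rpow (by positivity)
        (by positivity)]
      refine Real.rpow_le_rpow (by positivity) ?_ hs
      nlinarith [norm_nonneg ξ, mul_nonneg (by positivity : 0 ≤ 4 * Real.pi ^ 2) (norm_nonneg ξ)]
    have h3 : ‖f ξ‖ ^ 2 ≤ C ^ 2 * (1 + ‖ξ‖) ^ (-(2 * (s + d + 1))) := by
      calc ‖f ξ‖ ^ 2 ≤ (C * (1 + ‖ξ‖) ^ (-(s + d + 1))) ^ 2 := by gcongr; exact hf ξ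
        _ = _ := by
          rw [mul_pow, ← Real.rpow_natCast ((1 + ‖ξ‖) ^ _), ← Real.rpow_mul (by positivity)]
          congr 2; push_cast; ring
    calc _ ≤ ((4 * Real.pi ^ 2) ^ s * (1 + ‖ξ‖) ^ (2 * s)) *
          (C ^ 2 * (1 + ‖ξ‖) ^ (-(2 * (s + d + 1)))) := by gcongr
      _ = (4 * Real.pi ^ 2) ^ s * C ^ 2 * (1 + ‖ξ‖) ^ (-(2 * (d + 1))) := by
          rw [show -(2 * (d + 1)) = 2 * s + -(2 * (s + d + 1)) by ring,
            Real.rpow_add (by positivity)]; ring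
      _ ≤ _ := by
          gcongr
          linarith
  refine (lintegral_mono key).trans_lt ?_
  rw [lintegral_const_mul' _ _ ENNReal.ofReal_ne_top]
  exact ENNReal.mul_lt_top ENNReal.ofReal_lt_top (finite_integral_one_add_norm (by linarith))

lemma fourier_exp_inner_mul {E : Type*} [NormedAddCommGroup E] [InnerProductSpace ℝ E]
    [FiniteDimensional ℝ E] [MeasurableSpace E] [BorelSpace E] (H : E → ℂ) (c : ℂ) (a ζ : E) :
    𝓕 (fun ξ => c * (Complex.exp (2 * Real.pi * Complex.I * (inner ℝ a ξ : ℝ)) * H ξ)) ζ =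
      c * 𝓕 H (ζ - a) := by
  rw [Real.fourier_eq', Real.fourier_eq', ← integral_const_mul]
  refine integral_congr_ae (.of_forall fun ξ => ?_)
  simp only [smul_eq_mul]
  rw [inner_sub_right, real_inner_comm ξ a]
  have : Complex.exp (↑(-2 * Real.pi * (inner ℝ ξ ζ - inner ℝ a ξ)) * Complex.I) =
      Complex.exp (↑(-2 * Real.pi * inner ℝ ξ ζ) * Complex.I) *
        Complex.exp (2 * Real.pi * Complex.I * (inner ℝ a ξ : ℝ)) := by
    rw [← Complex.exp_add]; congr 1; push_cast; ring
  rw [real_inner_comm ξ a] at this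
  rw [this]; ring

lemma contDiff_exp_inner {E : Type*} [NormedAddCommGroup E] [InnerProductSpace ℝ E] (a : E) :
    ContDiff ℝ (⊤ : ℕ∞) fun ξ : E =>
      Complex.exp (2 * Real.pi * Complex.I * (inner ℝ a ξ : ℝ)) := by
  refine ContDiff.cexp (contDiff_const.mul ?_)
  exact Complex.ofRealCLM.contDiff.comp (contDiff_const.inner ℝ contDiff_id)

lemma sobolevNorm_eq_of_schwartz {n l : ℕ} (s : ℝ) (f : 𝓢(RnPow n l, ℂ)) :
    sobolevNorm s f = (∫⁻ ξ, ENNReal.ofReal ((1 + 4 * Real.pi ^ 2 * ‖ξ‖ ^ 2) ^ s) *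
      ‖(𝓕 f : 𝓢(RnPow n l, ℂ)) ξ‖ₑ ^ 2) ^ (1 / 2 : ℝ) := by
  have hf : MemLp f 2 volume := f.memLp 2
  rw [sobolevNorm, dif_pos hf]
  congr 1
  have h : 𝓕 (hf.toLp f) = (𝓕 f).toLp 2 volume := SchwartzMap.toLp_fourier_eq f
  rw [h]
  refine lintegral_congr_ae ?_
  filter_upwards [(𝓕 f).coeFn_toLp 2 volume] with ξ hξ
  rw [hξ]

/-- Modulating by frequency `a` costs at most `(1 + 4π²|a|²) ^ (s / 2)` in the Sobolev norm. -/
lemma exists_sobolevNorm_modulation_le {n l : ℕ} {s : ℝ} (hs : 0 ≤ s) {H : RnPow n l → ℂ}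
    (hc : HasCompactSupport H) (hd : ContDiff ℝ (⊤ : ℕ∞) H) :
    ∃ K : ℝ≥0∞, K < ⊤ ∧ ∀ (c : ℂ) (a : RnPow n l), sobolevNorm s
      (fun ξ => c * (Complex.exp (2 * Real.pi * Complex.I * (inner ℝ a ξ : ℝ)) * H ξ)) ≤
        (‖c‖ₑ ^ 2 * ENNReal.ofReal ((1 + 4 * Real.pi ^ 2 * ‖a‖ ^ 2) ^ s) * K) ^ (1 / 2 : ℝ) := by
  set Φ : 𝓢(RnPow n l, ℂ) := hc.toSchwartzMap hd
  have hΦ : (Φ : RnPow n l → ℂ) = H := rfl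
  refine ⟨ENNReal.ofReal (2 ^ s) * ∫⁻ ξ, ENNReal.ofReal ((1 + 4 * Real.pi ^ 2 * ‖ξ‖ ^ 2) ^ s) *
      ‖(𝓕 Φ : 𝓢(RnPow n l, ℂ)) ξ‖ₑ ^ 2,
    ENNReal.mul_lt_top ENNReal.ofReal_lt_top (lintegral_sobolev_lt_top _ hs), fun c a => ?_⟩
  have hc' : HasCompactSupport (fun ξ =>
      c * (Complex.exp (2 * Real.pi * Complex.I * (inner ℝ a ξ : ℝ)) * H ξ)) :=
    (hc.mul_left).mul_left
  have hd' : ContDiff ℝ (⊤ : ℕ∞) (fun ξ =>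
      c * (Complex.exp (2 * Real.pi * Complex.I * (inner ℝ a ξ : ℝ)) * H ξ)) :=
    contDiff_const.mul ((contDiff_exp_inner a).mul hd)
  set Γ : 𝓢(RnPow n l, ℂ) := hc'.toSchwartzMap hd'
  change sobolevNorm s Γ ≤ _
  rw [sobolevNorm_eq_of_schwartz]
  refine ENNReal.rpow_le_rpow ?_ (by norm_num)
  rw [← mul_assoc, ← lintegral_sub_right_eq_self (fun ξ =>
    ENNReal.ofReal ((1 + 4 * Real.pi ^ 2 * ‖ξ‖ ^ 2) ^ s) * ‖(𝓕 Φ : 𝓢(RnPow n l, ℂ)) ξ‖ₑ ^ 2) a,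
    ← lintegral_const_mul']
  · refine lintegral_mono fun ξ => ?_
    have h1 : (𝓕 Γ : 𝓢(RnPow n l, ℂ)) ξ = c * (𝓕 Φ : 𝓢(RnPow n l, ℂ)) (ξ - a) := by
      rw [SchwartzMap.fourier_coe, SchwartzMap.fourier_coe]
      exact fourier_exp_inner_mul H c a ξ
    rw [h1, enorm_mul, mul_pow]
    -- Peetre's inequality: `1 + |ξ|² ≤ 2 (1 + |a|²)(1 + |ξ - a|²)`, with the factors `4π²` carried
    -- along.
    have h2 : ENNReal.ofReal ((1 + 4 * Real.pi ^ 2 * ‖ξ‖ ^ 2) ^ s) ≤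
        ENNReal.ofReal ((1 + 4 * Real.pi ^ 2 * ‖a‖ ^ 2) ^ s) * ENNReal.ofReal (2 ^ s) *
          ENNReal.ofReal ((1 + 4 * Real.pi ^ 2 * ‖ξ - a‖ ^ 2) ^ s) := by
      rw [← ENNReal.ofReal_mul (by positivity), ← ENNReal.ofReal_mul (by positivity),
        ← Real.mul_rpow (by positivity) (by positivity),
        ← Real.mul_rpow (by positivity) (by positivity)]
      refine ENNReal.ofReal_le_ofReal (Real.rpow_le_rpow (by positivity) ?_ hs)
      have h3 : ‖ξ‖ ≤ ‖ξ - a‖ + ‖a‖ := by simpa using norm_add_le (ξ - a) a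
      have h4 : ‖ξ‖ ^ 2 ≤ 2 * ‖ξ - a‖ ^ 2 + 2 * ‖a‖ ^ 2 := by
        nlinarith [norm_nonneg ξ, norm_nonneg a, norm_nonneg (ξ - a),
          sq_nonneg (‖ξ - a‖ - ‖a‖)]
      set π2 := 4 * Real.pi ^ 2
      have : 0 ≤ π2 := by positivity
      nlinarith [mul_le_mul_of_nonneg_left h4 this,
        mul_nonneg (mul_nonneg this (sq_nonneg ‖a‖)) (mul_nonneg this (sq_nonneg ‖ξ - a‖))]
    calc _ ≤ _ := mul_le_mul_left h2 _
      _ = _ := by ring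
  · exact ENNReal.mul_ne_top (ENNReal.mul_ne_top (by simp) ENNReal.ofReal_ne_top)
      ENNReal.ofReal_ne_top

/-! ### The oscillating symbol and its Hörmander norm -/

/-- The symbol `θ(ξ) |ξ|^{-s} e^{2πi⟨a, ξ⟩}`. -/
noncomputable def oscillatingSymbol {n l : ℕ} (θ : RnPow n l → ℝ) (s : ℝ) (a ξ : RnPow n l) : ℂ :=
  (θ ξ : ℂ) * ((‖ξ‖ ^ (-s) : ℝ) : ℂ) *
    Complex.exp (2 * Real.pi * Complex.I * (inner ℝ a ξ : ℝ))

lemma contDiff_norm_rpow_mul {E : Type*} [NormedAddCommGroup E] [InnerProductSpace ℝ E] (s : ℝ)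
    {f : E → ℂ} (hf : ContDiff ℝ (⊤ : ℕ∞) f) (h0 : (0 : E) ∉ tsupport f) :
    ContDiff ℝ (⊤ : ℕ∞) fun ξ => ((‖ξ‖ ^ s : ℝ) : ℂ) * f ξ := by
  rw [contDiff_iff_contDiffAt]
  intro ξ
  by_cases hξ : ξ = 0
  · have h : (fun ξ => ((‖ξ‖ ^ s : ℝ) : ℂ) * f ξ) =ᶠ[nhds ξ] fun _ => 0 := by
      rw [hξ]
      filter_upwards [notMem_tsupport_iff_eventuallyEq.mp h0] with x hx
      simp [hx]
    exact contDiffAt_const.congr_of_eventuallyEq h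
  · refine ContDiffAt.mul ?_ hf.contDiffAt
    exact Complex.ofRealCLM.contDiff.contDiffAt.comp ξ
      ((contDiffAt_norm ℝ hξ).rpow_const_of_ne (norm_ne_zero_iff.mpr hξ))

/-- Dilation by `2ᵏ` turns `|ξ|^{-s}` into `2^{-ks} |ξ|^{-s}` and the phase vector `a` into `2ᵏ a`.
The modulation bound gives a factor of order at most `2^{ks}` for large `k`, so the two powers
cancel. The cutoff `θ` disposes of the low frequencies. -/
lemma hormanderNorm_oscillatingSymbol_lt_top {n l : ℕ} {Ψ : 𝓢(RnPow n l, ℂ)}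
    (hΨ : IsLittlewoodPaley Ψ) {s : ℝ} (hs : 0 ≤ s) {θ : RnPow n l → ℝ}
    (hθ : ContDiff ℝ (⊤ : ℕ∞) θ) (hθ0 : ∀ ξ, ‖ξ‖ ≤ 1 → θ ξ = 0) (hθ1 : ∀ ξ, 2 ≤ ‖ξ‖ → θ ξ = 1)
    (a : RnPow n l) : hormanderNorm Ψ s (oscillatingSymbol θ s a) < ⊤ := by
  set ψ : RnPow n l → ℂ := ⇑(𝓕 Ψ : 𝓢(RnPow n l, ℂ)) with hψ
  have hψs : ∀ ξ, ψ ξ ≠ 0 → 1 / 2 ≤ ‖ξ‖ ∧ ‖ξ‖ ≤ 2 := fun ξ h =>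
    hΨ.support_subset (subset_tsupport _ h)
  have hψc : HasCompactSupport ψ := by
    refine HasCompactSupport.of_support_subset_isCompact (isCompact_closedBall 0 2) fun ξ h => ?_
    simpa using (hψs ξ h).2
  have hψ0 : (0 : RnPow n l) ∉ tsupport ψ := fun h => by
    have := (hΨ.support_subset h).1
    simp at this
    linarith
  set Φ : RnPow n l → ℂ := fun ξ => ((‖ξ‖ ^ (-s) : ℝ) : ℂ) * ψ ξ with hΦ
  have hΦc : HasCompactSupport Φ := hψc.mul_left
  have hΦd : ContDiff ℝ (⊤ : ℕ∞) Φ :=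
    contDiff_norm_rpow_mul (-s) ((𝓕 Ψ : 𝓢(RnPow n l, ℂ)).smooth _) hψ0
  have hHc : ∀ t : ℝ, HasCompactSupport fun ξ => (θ (t • ξ) : ℂ) * Φ ξ := fun t => hΦc.mul_left
  have hHd : ∀ t : ℝ, ContDiff ℝ (⊤ : ℕ∞) fun ξ => (θ (t • ξ) : ℂ) * Φ ξ := fun t =>
    (Complex.ofRealCLM.contDiff.comp (hθ.comp (contDiff_const_smul t))).mul hΦd
  have hdil : ∀ k : ℤ, (fun ξ => oscillatingSymbol θ s a ((2 : ℝ) ^ k • ξ) * ψ ξ) = fun ξ =>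
      ((((2 : ℝ) ^ k) ^ (-s) : ℝ) : ℂ) * (Complex.exp (2 * Real.pi * Complex.I *
        (inner ℝ ((2 : ℝ) ^ k • a) ξ : ℝ)) * ((θ ((2 : ℝ) ^ k • ξ) : ℂ) * Φ ξ)) := by
    intro k
    funext ξ
    have h2 : (0 : ℝ) < 2 ^ k := by positivity
    rw [oscillatingSymbol, inner_smul_left, inner_smul_right, norm_smul,
      Real.norm_of_nonneg h2.le, Real.mul_rpow h2.le (norm_nonneg _)]
    simp only [hΦ, conj_trivial]
    push_cast
    ring
  have hfin : ∀ k : ℤ, sobolevNorm s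
      (fun ξ => oscillatingSymbol θ s a ((2 : ℝ) ^ k • ξ) * ψ ξ) < ⊤ := by
    intro k
    obtain ⟨K, hK, h⟩ := exists_sobolevNorm_modulation_le hs (hHc _) (hHd ((2 : ℝ) ^ k))
    rw [hdil]
    refine (h _ _).trans_lt (ENNReal.rpow_lt_top_of_nonneg (by norm_num) ?_)
    exact ENNReal.mul_ne_top (ENNReal.mul_ne_top (by simp) ENNReal.ofReal_ne_top) hK.ne
  obtain ⟨K, hK, hlarge⟩ := exists_sobolevNorm_modulation_le hs hΦc hΦd
  set B : ℝ≥0∞ := (ENNReal.ofReal ((1 + 4 * Real.pi ^ 2 * ‖a‖ ^ 2) ^ s) * K) ^ (1 / 2 : ℝ) with hB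
  have hBt : B < ⊤ := ENNReal.rpow_lt_top_of_nonneg (by norm_num)
    (ENNReal.mul_ne_top ENNReal.ofReal_ne_top hK.ne)
  set S : ℤ → ℝ≥0∞ := fun k => sobolevNorm s
      (fun ξ => oscillatingSymbol θ s a ((2 : ℝ) ^ k • ξ) * ψ ξ) with hS
  -- On the annulus `1/2 ≤ |ξ| ≤ 2` the dilated cutoff is `0` for `k ≤ -1` and `1` for `k ≥ 2`. Only
  -- `k = 0, 1` see its transition, and those two norms are merely finite.
  have hall : ∀ k : ℤ, S k ≤ max B (max (S 0) (max (S 1) (S (-1)))) := by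
    intro k
    have hcases : k = 0 ∨ k = 1 ∨ k ≤ -1 ∨ 2 ≤ k := by omega
    rcases hcases with rfl | rfl | hk | hk
    · simp
    · simp
    · have hz : ∀ j : ℤ, j ≤ -1 →
          (fun ξ => oscillatingSymbol θ s a ((2 : ℝ) ^ j • ξ) * ψ ξ) = fun _ => 0 := by
        intro j hj
        funext ξ
        by_cases h : ψ ξ = 0
        · simp [h]
        · have h2 : ((2 : ℝ) ^ j) ≤ 2⁻¹ := by
            simpa using zpow_le_zpow_right₀ (by norm_num : (1 : ℝ) ≤ 2) hj
          rw [oscillatingSymbol, hθ0]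
          · simp
          · rw [norm_smul, Real.norm_of_nonneg (by positivity)]
            calc _ ≤ (2 : ℝ)⁻¹ * 2 := by gcongr; exact (hψs ξ h).2
              _ = 1 := by norm_num
      have : S k = S (-1) := by simp only [hS]; rw [hz k hk, hz (-1) le_rfl]
      rw [this]; simp
    · refine le_trans ?_ (le_max_left _ _)
      have h4 : (4 : ℝ) ≤ 2 ^ k := by
        calc (4 : ℝ) = 2 ^ (2 : ℤ) := by norm_num
          _ ≤ 2 ^ k := zpow_le_zpow_right₀ (by norm_num) hk
      have hθk : (fun ξ => ((((2 : ℝ) ^ k) ^ (-s) : ℝ) : ℂ) * (Complex.exp (2 * Real.pi *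
          Complex.I * (inner ℝ ((2 : ℝ) ^ k • a) ξ : ℝ)) * ((θ ((2 : ℝ) ^ k • ξ) : ℂ) * Φ ξ))) =
          fun ξ => ((((2 : ℝ) ^ k) ^ (-s) : ℝ) : ℂ) * (Complex.exp (2 * Real.pi *
          Complex.I * (inner ℝ ((2 : ℝ) ^ k • a) ξ : ℝ)) * Φ ξ) := by
        funext ξ
        by_cases h : ψ ξ = 0
        · simp [hΦ, h]
        · rw [hθ1]
          · simp
          · rw [norm_smul, Real.norm_of_nonneg (by positivity)]
            nlinarith [(hψs ξ h).1]
      simp only [hS]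
      rw [hdil, hθk]
      refine (hlarge _ _).trans (ENNReal.rpow_le_rpow ?_ (by norm_num))
      refine mul_le_mul_left ?_ _
      have h0 : (0 : ℝ) < 2 ^ k := by positivity
      rw [← ofReal_norm, Complex.norm_real, Real.norm_of_nonneg (by positivity),
        ← ENNReal.ofReal_pow (by positivity), ← ENNReal.ofReal_mul (by positivity)]
      refine ENNReal.ofReal_le_ofReal ?_
      rw [← Real.rpow_natCast, ← Real.rpow_mul h0.le,
        show -s * ((2 : ℕ) : ℝ) = ((2 : ℕ) : ℝ) * -s by ring, Real.rpow_mul h0.le,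
        Real.rpow_natCast, Real.rpow_neg (by positivity), ← Real.inv_rpow (by positivity),
        ← Real.mul_rpow (by positivity) (by positivity)]
      -- What remains is `4^{-k} (1 + 4π² 4ᵏ |a|²) ≤ 1 + 4π² |a|²`.
      refine Real.rpow_le_rpow (by positivity) ?_ hs
      rw [norm_smul, Real.norm_of_nonneg h0.le, mul_add, mul_one]
      have : ((2 : ℝ) ^ k) ^ 2 ≥ 1 := by nlinarith
      refine add_le_add (inv_le_one_of_one_le₀ this) (le_of_eq ?_)
      field_simp
  refine (iSup_le hall).trans_lt ?_
  simp only [max_lt_iff]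
  exact ⟨hBt, hfin 0, hfin 1, hfin (-1)⟩

/-! ### Averages of a power weight over cubes -/

lemma lintegral_comp_smul_sub {n : ℕ} (f : Rn n → ℝ≥0∞) (c : Rn n) {R : ℝ} (hR : 0 < R) :
    ∫⁻ x, f (R • (x - c)) = ENNReal.ofReal (R ^ n)⁻¹ * ∫⁻ x, f x := by
  rw [lintegral_sub_right_eq_self (fun x => f (R • x)) c]
  have h := lintegral_map_equiv (μ := (volume : Measure (Rn n))) f
    (Homeomorph.smulOfNeZero R hR.ne').toMeasurableEquiv
  have h2 : Measure.map (Homeomorph.smulOfNeZero R hR.ne' : Rn n ≃ₜ Rn n).toMeasurableEquiv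
      (volume : Measure (Rn n)) = ENNReal.ofReal (R ^ n)⁻¹ • volume := by
    have := Measure.map_addHaar_smul (volume : Measure (Rn n)) hR.ne'
    rw [finrank_euclideanSpace_fin, abs_of_pos (by positivity)] at this
    exact this
  rw [h2, lintegral_smul_measure] at h
  simpa using h.symm

lemma lintegral_unitBall_rpow_lt_top {n : ℕ} {α : ℝ} (hα : 0 < α) (hn : α < n) :
    ∫⁻ x in Metric.closedBall (0 : Rn n) 1, ((‖x‖₊ ^ (-α) : ℝ≥0) : ℝ≥0∞) < ⊤ := by
  have hn0 : 0 < n := by exact_mod_cast hα.trans hn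
  have : Nonempty (Fin n) := ⟨⟨0, hn0⟩⟩
  have h := (integrable_fun_norm_addHaar (E := Rn n) (volume : Measure (Rn n))
    (f := (Set.Iic (1 : ℝ)).indicator fun y => y ^ (-α))).mpr ?_
  · have h3 := h.2
    rw [hasFiniteIntegral_iff_enorm] at h3
    rw [← lintegral_indicator Metric.isClosed_closedBall.measurableSet]
    refine lt_of_le_of_lt (lintegral_mono fun x => ?_) h3
    by_cases hx : ‖x‖ ≤ 1
    · rw [Set.indicator_of_mem (by simpa using hx), Set.indicator_of_mem (by simpa using hx),
        Real.enorm_eq_ofReal (by positivity), ← coe_nnnorm, ← NNReal.coe_rpow, ENNReal.ofReal_coe_nnreal]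
    · rw [Set.indicator_of_notMem (by simpa using hx)]
      exact zero_le
  · rw [finrank_euclideanSpace_fin]
    -- Polar coordinates: the radial density is `y^{n-1-α}`, integrable at `0` because `α < n`.
    have h1 : IntegrableOn (fun y : ℝ => y ^ ((n : ℝ) - 1 - α)) (Set.Ioc 0 1) := by
      rw [integrableOn_Ioc_iff_integrableOn_Ioo, intervalIntegral.integrableOn_Ioo_rpow_iff one_pos]
      linarith
    have h2 := (integrable_indicator_iff measurableSet_Ioc).mpr h1
    refine h2.integrableOn.congr_fun (fun y hy => ?_) measurableSet_Ioi
    have hy0 : 0 < y := hy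
    by_cases hy1 : y ≤ 1
    · rw [Set.indicator_of_mem (show y ∈ Set.Ioc 0 1 from ⟨hy0, hy1⟩)]
      simp only [smul_eq_mul]
      rw [Set.indicator_of_mem (show y ∈ Set.Iic 1 from hy1), ← Real.rpow_natCast,
        ← Real.rpow_add hy0, Nat.cast_sub hn0]
      congr 1; push_cast; ring
    · rw [Set.indicator_of_notMem (fun h => hy1 h.2)]
      simp only [smul_eq_mul]
      rw [Set.indicator_of_notMem (show y ∉ Set.Iic 1 from hy1), mul_zero]

lemma exists_lintegral_ball_rpow_le {n : ℕ} {α : ℝ} (hα : 0 < α) (hn : α < n) :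
    ∃ K : ℝ≥0, ∀ (c : Rn n) (D : ℝ≥0), 0 < D →
      ∫⁻ x in Metric.closedBall c D, ((‖x - c‖₊ ^ (-α) : ℝ≥0) : ℝ≥0∞) ≤
        ((K * D ^ ((n : ℝ) - α) : ℝ≥0) : ℝ≥0∞) := by
  refine ⟨(∫⁻ x in Metric.closedBall (0 : Rn n) 1, ((‖x‖₊ ^ (-α) : ℝ≥0) : ℝ≥0∞)).toNNReal,
    fun c D hD => ?_⟩
  rw [ENNReal.coe_mul, ENNReal.coe_toNNReal (lintegral_unitBall_rpow_lt_top hα hn).ne,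
    ← lintegral_indicator Metric.isClosed_closedBall.measurableSet,
    ← lintegral_indicator Metric.isClosed_closedBall.measurableSet]
  have hD' : (0 : ℝ) < D := hD
  have h := lintegral_comp_smul_sub (((Metric.closedBall (0 : Rn n) 1).indicator fun x =>
    ((‖x‖₊ ^ (-α) : ℝ≥0) : ℝ≥0∞))) c (inv_pos.mpr hD')
  have h2 : ∀ x : Rn n, (Metric.closedBall c D).indicator (fun x =>
      ((‖x - c‖₊ ^ (-α) : ℝ≥0) : ℝ≥0∞)) x = ((D ^ (-α) : ℝ≥0) : ℝ≥0∞) *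
        (Metric.closedBall (0 : Rn n) 1).indicator (fun x => ((‖x‖₊ ^ (-α) : ℝ≥0) : ℝ≥0∞))
          ((D : ℝ)⁻¹ • (x - c)) := by
    intro x
    have hn' : ‖(D : ℝ)⁻¹ • (x - c)‖₊ = D⁻¹ * ‖x - c‖₊ := by
      rw [nnnorm_smul]; congr 1; ext; simp
    by_cases hx : x ∈ Metric.closedBall c D
    · have hx' : (D : ℝ)⁻¹ • (x - c) ∈ Metric.closedBall (0 : Rn n) 1 := by
        rw [mem_closedBall_zero_iff, norm_smul, norm_inv, Real.norm_of_nonneg hD'.le,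
          inv_mul_le_one₀ hD', ← dist_eq_norm]
        exact hx
      rw [Set.indicator_of_mem hx, Set.indicator_of_mem hx', ← ENNReal.coe_mul, hn',
        ← NNReal.mul_rpow, mul_inv_cancel_left₀ hD.ne']
    · have hx' : (D : ℝ)⁻¹ • (x - c) ∉ Metric.closedBall (0 : Rn n) 1 := by
        rw [mem_closedBall_zero_iff, norm_smul, norm_inv, Real.norm_of_nonneg hD'.le,
          inv_mul_le_one₀ hD', ← dist_eq_norm]
        exact hx
      rw [Set.indicator_of_notMem hx, Set.indicator_of_notMem hx', mul_zero]
  rw [lintegral_congr h2, lintegral_const_mul' _ _ ENNReal.coe_ne_top, h, ← mul_assoc, mul_comm]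
  refine le_of_eq ?_
  congr 1
  rw [ENNReal.ofReal, ← ENNReal.coe_mul]
  congr 1
  ext
  rw [NNReal.coe_mul, Real.coe_toNNReal _ (by positivity), NNReal.coe_rpow, NNReal.coe_rpow,
    ← inv_pow, inv_inv, ← Real.rpow_natCast, ← Real.rpow_add hD']
  congr 1; ring

lemma measurableSet_cube {n : ℕ} (a : Rn n) (r : ℝ) : MeasurableSet (cube a r) := by
  have : cube a r = ⋂ i, (fun x : Rn n => x i) ⁻¹' Set.Icc (a i) (a i + r) := by
    ext x; simp [cube]
  rw [this]
  exact MeasurableSet.iInter fun i => measurableSet_Icc.preimage (by fun_prop)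

lemma volume_cube {n : ℕ} (a : Rn n) {r : ℝ} : volume (cube a r) = ENNReal.ofReal r ^ n := by
  have h := (PiLp.volume_preserving_ofLp (Fin n)).measure_preimage
    (s := Set.Icc (fun i => a i) (fun i => a i + r)) measurableSet_Icc.nullMeasurableSet
  rw [Real.volume_Icc_pi] at h
  have h2 : cube a r = WithLp.ofLp ⁻¹' Set.Icc (fun i => a i) (fun i => a i + r) := by
    ext x
    simp only [cube, Set.mem_ofPred_eq, Set.mem_preimage, Set.mem_Icc, Pi.le_def]
    exact forall_and
  rw [h2]
  simpa using h

lemma norm_sub_le_of_mem_cube {n : ℕ} {a x : Rn n} {r : ℝ} (hr : 0 < r) (hx : x ∈ cube a r) :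
    ‖x - a‖ ≤ √n * r := by
  rw [EuclideanSpace.norm_eq, ← Real.sqrt_sq hr.le, ← Real.sqrt_mul (Nat.cast_nonneg n)]
  refine Real.sqrt_le_sqrt ?_
  calc ∑ i, ‖(x - a) i‖ ^ 2 ≤ ∑ _i : Fin n, r ^ 2 := by
        refine Finset.sum_le_sum fun i _ => ?_
        have := hx i
        rw [PiLp.sub_apply, Real.norm_eq_abs, sq_abs]
        exact pow_le_pow_left₀ (by linarith [this.1]) (by linarith [this.2]) 2
    _ = n * r ^ 2 := by simp

lemma setLAverage_mono_ae {X : Type*} [MeasurableSpace X] {μ : Measure X} {s : Set X}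
    (hs : MeasurableSet s) {f g : X → ℝ≥0∞} (h : ∀ᵐ x ∂μ, x ∈ s → f x ≤ g x) :
    (⨍⁻ x in s, f x ∂μ) ≤ ⨍⁻ x in s, g x ∂μ := by
  rw [setLAverage_eq, setLAverage_eq]
  exact ENNReal.div_le_div_right (setLIntegral_mono_ae' hs h) _

/-- The power weight `|x - c|^{-α}`, `0 < α < n`, satisfies the `A₁` condition on cubes, with the
infimum over the cube replaced by the value at the largest distance `D` to `c`. -/
lemma exists_setLAverage_cube_rpow_le {n : ℕ} {α : ℝ} (hα : 0 < α) (hn : α < n) :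
    ∃ K : ℝ≥0, ∀ (c a : Rn n) (r : ℝ), 0 < r → ∃ D : ℝ≥0, 0 < D ∧
      (∀ x ∈ cube a r, ‖x - c‖₊ ≤ D) ∧
      (⨍⁻ x in cube a r, ((‖x - c‖₊ ^ (-α) : ℝ≥0) : ℝ≥0∞) ∂volume) ≤ ((K * D ^ (-α) : ℝ≥0) : ℝ≥0∞) := by
  have hn0 : 0 < n := by exact_mod_cast hα.trans hn
  have hn' : (0 : ℝ) < √n := Real.sqrt_pos.mpr (by exact_mod_cast hn0)
  obtain ⟨K₀, hK₀⟩ := exists_lintegral_ball_rpow_le (n := n) hα hn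
  set N : ℝ≥0 := Real.toNNReal (3 * √n) with hN
  refine ⟨max (3 ^ α) (K₀ * N ^ (n : ℝ)), fun c a r hr => ?_⟩
  set D : ℝ≥0 := Real.toNNReal (‖a - c‖ + √n * r) with hD
  have hDc : (D : ℝ) = ‖a - c‖ + √n * r := Real.coe_toNNReal _ (by positivity)
  have hD0 : 0 < D := by
    rw [← NNReal.coe_pos, hDc]; positivity
  have hvol0 : volume (cube a r) ≠ 0 := by
    rw [volume_cube]; exact pow_ne_zero _ (by simpa using hr)
  have hvolt : volume (cube a r) ≠ ⊤ := by
    rw [volume_cube]; exact ENNReal.pow_ne_top ENNReal.ofReal_ne_top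
  have hmem : ∀ x ∈ cube a r, ‖x - c‖₊ ≤ D := by
    intro x hx
    rw [← NNReal.coe_le_coe, hDc, coe_nnnorm]
    calc ‖x - c‖ = ‖(x - a) + (a - c)‖ := by congr 1; abel
      _ ≤ ‖x - a‖ + ‖a - c‖ := norm_add_le _ _
      _ ≤ _ := by linarith [norm_sub_le_of_mem_cube hr hx]
  refine ⟨D, hD0, hmem, ?_⟩
  -- Far from `c` the weight is essentially constant on the cube, with `|x - c| ≥ D/3`. Near `c` the
  -- cube lies in the ball of radius `D ≤ 3√n r`, whose volume is comparable to that of the cube.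
  rcases le_or_gt (2 * (√n * r)) ‖a - c‖ with hfar | hnear
  · have hpt : ∀ x ∈ cube a r, ‖x - c‖₊ ^ (-α) ≤ 3 ^ α * D ^ (-α) := by
      intro x hx
      have h1 : D / 3 ≤ ‖x - c‖₊ := by
        rw [← NNReal.coe_le_coe, NNReal.coe_div, hDc, coe_nnnorm]
        have h2 := norm_sub_le_of_mem_cube hr hx
        have h3 : ‖a - c‖ ≤ ‖x - a‖ + ‖x - c‖ := by
          calc ‖a - c‖ = ‖(x - c) - (x - a)‖ := by congr 1; abel
            _ ≤ _ := by rw [add_comm]; exact norm_sub_le _ _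
        push_cast
        linarith
      calc ‖x - c‖₊ ^ (-α) ≤ (D / 3) ^ (-α) :=
            NNReal.rpow_le_rpow_of_nonpos (by positivity) h1 (by linarith)
        _ = 3 ^ α * D ^ (-α) := by
            rw [NNReal.div_rpow, NNReal.rpow_neg 3, div_inv_eq_mul, mul_comm]
    refine (setLAverage_mono_ae (g := fun _ => ((3 ^ α * D ^ (-α) : ℝ≥0) : ℝ≥0∞))
      (measurableSet_cube a r) (Filter.Eventually.of_forall fun x hx => ?_)).trans ?_
    · exact ENNReal.coe_le_coe.mpr (hpt x hx)
    · rw [setLAverage_const hvol0 hvolt]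
      refine ENNReal.coe_le_coe.mpr ?_
      gcongr
      exact le_max_left _ _
  · have hsub : cube a r ⊆ Metric.closedBall c D := fun x hx => by
      rw [mem_closedBall_iff_norm]; exact hmem x hx
    have hDr : D ≤ N * Real.toNNReal r := by
      rw [← NNReal.coe_le_coe, hDc, NNReal.coe_mul, Real.coe_toNNReal _ hr.le,
        Real.coe_toNNReal _ (by positivity)]
      linarith
    rw [setLAverage_eq, volume_cube]
    refine ENNReal.div_le_of_le_mul ?_
    calc _ ≤ ∫⁻ x in Metric.closedBall c D, ((‖x - c‖₊ ^ (-α) : ℝ≥0) : ℝ≥0∞) :=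
          lintegral_mono_set hsub
      _ ≤ _ := hK₀ c D hD0
      _ ≤ ((max (3 ^ α) (K₀ * N ^ (n : ℝ)) * D ^ (-α) * (Real.toNNReal r) ^ n : ℝ≥0) : ℝ≥0∞) := by
          refine ENNReal.coe_le_coe.mpr ?_
          calc K₀ * D ^ ((n : ℝ) - α) = K₀ * (D ^ (n : ℝ) * D ^ (-α)) := by
                rw [sub_eq_add_neg, NNReal.rpow_add hD0.ne']
            _ ≤ K₀ * ((N * Real.toNNReal r) ^ (n : ℝ) * D ^ (-α)) := by gcongr
            _ = K₀ * N ^ (n : ℝ) * D ^ (-α) * (Real.toNNReal r) ^ n := by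
                rw [NNReal.mul_rpow, NNReal.rpow_natCast (Real.toNNReal r)]; ring
            _ ≤ _ := by gcongr; exact le_max_right _ _
      _ = _ := by push_cast; rfl

/-! ### Products of two power weights in the multilinear class -/

/-- The weight `|x|^{-α} |x - e|^β`. -/
noncomputable def twoPowerWeight {n : ℕ} (α β : ℝ) (e x : Rn n) : ℝ≥0 :=
  ‖x‖₊ ^ (-α) * ‖x - e‖₊ ^ β

lemma NNReal.prod_rpow_eq_rpow_sum {ι : Type*} {a : ℝ≥0} (ha : 0 < a) (f : ι → ℝ)
    (s : Finset ι) : ∏ i ∈ s, a ^ f i = a ^ ∑ i ∈ s, f i := by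
  ext
  push_cast
  exact (Real.rpow_sum_of_pos (NNReal.coe_pos.mpr ha) f s).symm

lemma jointExponent_div {l : ℕ} (P : Fin l → ℝ) (q : ℝ) :
    jointExponent (fun j => P j / q) = jointExponent P / q := by
  simp only [jointExponent, one_div_div, div_eq_mul_inv q, ← Finset.mul_sum, ← one_div]
  simp [div_eq_mul_inv, mul_comm]

lemma jointWeight_div {n l : ℕ} (P : Fin l → ℝ) {q : ℝ} (hq : q ≠ 0) (w : Fin l → Rn n → ℝ≥0) :
    jointWeight (fun j => P j / q) w = jointWeight P w := by
  funext x
  simp only [jointWeight, jointExponent_div]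
  simp_rw [div_div_div_cancel_right₀ hq]

/-- The exponents `r/Tⱼ` sum to `1`, which preserves `|x|^{-α}` and gives `|x - e|` the exponent
`α(l r - 1)`. The two centres are excluded because adding exponents fails for powers of zero. -/
lemma jointWeight_twoPowerWeight {n l : ℕ} {T : Fin l → ℝ} (hT : 0 < jointExponent T)
    (hT0 : ∀ j, T j ≠ 0) (α : ℝ) {e x : Rn n} (hx : x ≠ 0) (hxe : x ≠ e) :
    jointWeight T (fun j => twoPowerWeight α (α * (T j - 1)) e) x =
      twoPowerWeight α (α * (l * jointExponent T - 1)) e x := by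
  set r := jointExponent T with hr
  have hsum : ∑ j, r / T j = 1 := by
    have : ∑ j, r / T j = r * ∑ j, 1 / T j := by
      rw [Finset.mul_sum]; exact Finset.sum_congr rfl fun j _ => by ring
    rw [this, hr, jointExponent]
    refine inv_mul_cancel₀ fun h => ?_
    rw [hr, jointExponent, h, inv_zero] at hT
    exact hT.false
  simp only [jointWeight, twoPowerWeight, NNReal.mul_rpow, ← NNReal.rpow_mul]
  rw [Finset.prod_mul_distrib, NNReal.prod_rpow_eq_rpow_sum (by simpa using hx),
    NNReal.prod_rpow_eq_rpow_sum (by simpa [sub_eq_zero] using hxe), ← Finset.mul_sum, ← hr, hsum]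
  congr 2
  · ring
  · calc ∑ j, α * (T j - 1) * (r / T j) = ∑ j, (α * r - α * (r / T j)) :=
        Finset.sum_congr rfl fun j _ => by have := hT0 j; field_simp
      _ = _ := by
        have h1 : ∑ j, α * (r / T j) = α := by rw [← Finset.mul_sum, hsum, mul_one]
        rw [Finset.sum_sub_distrib, h1, Finset.sum_const, Finset.card_univ, Fintype.card_fin,
          nsmul_eq_mul]
        ring

lemma measurable_twoPowerWeight {n : ℕ} (α β : ℝ) (e : Rn n) :
    Measurable (twoPowerWeight α β e) := by
  unfold twoPowerWeight
  fun_prop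

lemma lintegral_ball_twoPowerWeight_lt_top {n : ℕ} {α β : ℝ} (hα : 0 < α) (hn : α < n)
    (hβ : 0 ≤ β) (e : Rn n) (R : ℝ≥0) (hR : 0 < R) :
    ∫⁻ x in Metric.closedBall (0 : Rn n) R, (twoPowerWeight α β e x : ℝ≥0∞) < ⊤ := by
  obtain ⟨K, hK⟩ := exists_lintegral_ball_rpow_le (n := n) hα hn
  have h : ∀ x ∈ Metric.closedBall (0 : Rn n) R, (twoPowerWeight α β e x : ℝ≥0∞) ≤
      (((R + ‖e‖₊) ^ β : ℝ≥0) : ℝ≥0∞) * ((‖x - 0‖₊ ^ (-α) : ℝ≥0) : ℝ≥0∞) := by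
    intro x hx
    rw [← ENNReal.coe_mul, sub_zero, mul_comm, twoPowerWeight]
    refine ENNReal.coe_le_coe.mpr (mul_le_mul_right (NNReal.rpow_le_rpow ?_ hβ) _)
    rw [mem_closedBall_zero_iff] at hx
    exact (nnnorm_sub_le x e).trans (add_le_add_left (by exact_mod_cast hx) _)
  refine (setLIntegral_mono' Metric.isClosed_closedBall.measurableSet h).trans_lt ?_
  rw [lintegral_const_mul' _ _ ENNReal.coe_ne_top]
  exact ENNReal.mul_lt_top ENNReal.coe_lt_top ((hK 0 R hR).trans_lt ENNReal.coe_lt_top)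

lemma locallyIntegrable_twoPowerWeight {n : ℕ} {α β : ℝ} (hα : 0 < α) (hn : α < n)
    (hβ : 0 ≤ β) (e : Rn n) :
    LocallyIntegrable (fun x => (twoPowerWeight α β e x : ℝ)) volume := by
  rw [locallyIntegrable_iff]
  intro k hk
  obtain ⟨R, hR0, hR⟩ := hk.isBounded.subset_closedBall_lt 0 0
  refine IntegrableOn.mono_set ?_ hR
  refine ⟨(measurable_twoPowerWeight α β e).coe_nnreal_real.aestronglyMeasurable, ?_⟩
  rw [hasFiniteIntegral_iff_enorm]
  have := lintegral_ball_twoPowerWeight_lt_top hα hn hβ e ⟨R, hR0.le⟩ hR0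
  simp only [NNReal.enorm_eq]
  exact this

lemma ae_ne_point {n : ℕ} (hn : 0 < n) (c : Rn n) : ∀ᵐ x : Rn n, x ≠ c := by
  have : Nonempty (Fin n) := ⟨⟨0, hn⟩⟩
  simp [ae_iff]

lemma setLAverage_le_const_mul {n : ℕ} {a : Rn n} {r : ℝ} {f g : Rn n → ℝ≥0} {C M : ℝ≥0}
    (h : ∀ᵐ x, x ∈ cube a r → f x ≤ C * g x)
    (hM : (⨍⁻ x in cube a r, (g x : ℝ≥0∞) ∂volume) ≤ M) :
    (⨍⁻ x in cube a r, (f x : ℝ≥0∞) ∂volume) ≤ ((C * M : ℝ≥0) : ℝ≥0∞) := by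
  rw [setLAverage_eq] at hM ⊢
  have h1 : ∫⁻ x in cube a r, (f x : ℝ≥0∞) ≤ C * ∫⁻ x in cube a r, (g x : ℝ≥0∞) := by
    rw [← lintegral_const_mul' _ _ ENNReal.coe_ne_top]
    refine setLIntegral_mono_ae' (measurableSet_cube a r) ?_
    filter_upwards [h] with x hx hxa
    rw [← ENNReal.coe_mul]
    exact ENNReal.coe_le_coe.mpr (hx hxa)
  refine (ENNReal.div_le_div_right h1 _).trans ?_
  rw [mul_div_assoc, ENNReal.coe_mul]
  exact mul_le_mul_right hM _

/-- The tuple `(|x|^{-α} |x - e|^{α (Tⱼ - 1)})ⱼ` belongs to `A_T`. -/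
lemma isMultiWeight_twoPowerWeight {n l : ℕ} {T : Fin l → ℝ} (hl : 0 < l) (hT : ∀ j, 1 < T j)
    {α : ℝ} (hα : 0 < α) (hn : α < n) (e : Rn n) :
    IsMultiWeight T (fun j => twoPowerWeight α (α * (T j - 1)) e) := by
  have hn0 : 0 < n := by exact_mod_cast hα.trans hn
  have hT0 : ∀ j, 0 < T j := fun j => one_pos.trans (hT j)
  have : Nonempty (Fin l) := ⟨⟨0, hl⟩⟩
  have hsum0 : 0 < ∑ j, 1 / T j :=
    Finset.sum_pos (fun j _ => one_div_pos.mpr (hT0 j)) Finset.univ_nonempty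
  have hr0 : 0 < jointExponent T := inv_pos.mpr hsum0
  set r := jointExponent T with hr
  have hrsum : 1 / r = ∑ j, 1 / T j := by rw [hr, jointExponent, one_div, inv_inv]
  have hlr : 1 ≤ l * r := by
    have : 1 / r ≤ l := by
      rw [hrsum]
      calc ∑ j, 1 / T j ≤ ∑ _j : Fin l, (1 : ℝ) :=
            Finset.sum_le_sum fun j _ => (div_le_one (hT0 j)).mpr (hT j).le
        _ = l := by simp
    -- This makes `γ` below nonnegative, so that `|x - e|^γ` can be bounded by its value at the
    -- largest distance.
    rwa [div_le_iff₀ hr0] at this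
  have hne : ∀ᵐ x : Rn n, x ≠ 0 ∧ x ≠ e := (ae_ne_point hn0 0).and (ae_ne_point hn0 e)
  refine ⟨fun j => locallyIntegrable_twoPowerWeight hα hn
    (mul_nonneg hα.le (by linarith [hT j])) e, fun j => ?_, ?_⟩
  · filter_upwards [hne] with x hx
    exact mul_pos (NNReal.rpow_pos (by simpa using hx.1))
      (NNReal.rpow_pos (by simpa [sub_eq_zero] using hx.2))
  obtain ⟨K, hK⟩ := exists_setLAverage_cube_rpow_le (n := n) hα hn
  set S : ℝ≥0 := K ^ (1 / r) * ∏ j, K ^ (1 / (T j).conjExponent) with hS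
  refine lt_of_le_of_lt (b := (S : ℝ≥0∞)) ?_ ENNReal.coe_lt_top
  refine iSup_le fun a => iSup_le fun ρ => iSup_le fun hρ => ?_
  -- `A` and `B` bound the distances from points of the cube to `0` and `e`. In each factor the
  -- negative power is averaged by the `A₁` condition and the nonnegative power is replaced by its
  -- bound.
  obtain ⟨A, hA0, hA, hAavg⟩ := hK 0 a ρ hρ
  obtain ⟨B, hB0, hB, hBavg⟩ := hK e a ρ hρ
  simp only [sub_zero] at hA hAavg
  set γ := α * (l * r - 1) with hγ
  have hγ0 : 0 ≤ γ := mul_nonneg hα.le (by linarith)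
  have hjoint : (⨍⁻ x in cube a ρ,
      (jointWeight T (fun j => twoPowerWeight α (α * (T j - 1)) e) x : ℝ≥0∞) ∂volume) ^ (1 / r) ≤
        ((K ^ (1 / r) * (A ^ (-α * (1 / r)) * B ^ (γ * (1 / r))) : ℝ≥0) : ℝ≥0∞) := by
    have h1 := setLAverage_le_const_mul (C := B ^ γ)
      (f := jointWeight T (fun j => twoPowerWeight α (α * (T j - 1)) e)) (a := a) (r := ρ)
      (g := fun x => ‖x‖₊ ^ (-α)) (M := K * A ^ (-α)) ?_ hAavg
    · refine (ENNReal.rpow_le_rpow h1 (by positivity)).trans (le_of_eq ?_)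
      rw [← ENNReal.coe_rpow_of_nonneg _ (by positivity)]
      congr 1
      rw [NNReal.mul_rpow, NNReal.mul_rpow, ← NNReal.rpow_mul, ← NNReal.rpow_mul]
      ring
    · filter_upwards [hne] with x hx hxa
      rw [jointWeight_twoPowerWeight hr0 (fun j => (hT0 j).ne') α hx.1 hx.2, twoPowerWeight,
        mul_comm]
      gcongr
      exact hB x hxa
  have hdual : ∀ j, dualFactor (T j) (twoPowerWeight α (α * (T j - 1)) e) (cube a ρ) ≤
      ((K ^ (1 / (T j).conjExponent) *
        (A ^ (α * (1 / T j)) * B ^ (-α * (1 - 1 / T j))) : ℝ≥0) : ℝ≥0∞) := by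
    intro j
    have ht := hT j
    have ht0 := hT0 j
    set t := T j
    have ht1 : 0 < t - 1 := by linarith
    have hc : t.conjExponent = t / (t - 1) := rfl
    have hc1 : 1 - t.conjExponent = -(1 / (t - 1)) := by rw [hc]; field_simp; ring
    have hc2 : 1 / t.conjExponent = 1 - 1 / t := by rw [hc]; field_simp
    have hc3 : 0 ≤ 1 / t.conjExponent := by rw [hc]; positivity
    rw [dualFactor, if_neg ht.ne']
    -- Here `1 - t' < 0`, and a negative power of zero is `⊤` in `ℝ≥0∞` but `0` in `ℝ≥0`; the two
    -- readings agree off the null set where the weight vanishes.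
    have hpt : ∀ᵐ x : Rn n, (twoPowerWeight α (α * (t - 1)) e x : ℝ≥0∞) ^ (1 - t.conjExponent) =
        ((twoPowerWeight α (α * (t - 1)) e x ^ (1 - t.conjExponent) : ℝ≥0) : ℝ≥0∞) := by
      filter_upwards [hne] with x hx
      refine (ENNReal.coe_rpow_of_ne_zero (ne_of_gt ?_) _).symm
      exact mul_pos (NNReal.rpow_pos (by simpa using hx.1))
        (NNReal.rpow_pos (by simpa [sub_eq_zero] using hx.2))
    have hcongr : (⨍⁻ x in cube a ρ,
        (twoPowerWeight α (α * (t - 1)) e x : ℝ≥0∞) ^ (1 - t.conjExponent) ∂volume) =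
        ⨍⁻ x in cube a ρ,
          ((twoPowerWeight α (α * (t - 1)) e x ^ (1 - t.conjExponent) : ℝ≥0) : ℝ≥0∞) ∂volume := by
      rw [setLAverage_eq, setLAverage_eq, lintegral_congr_ae (ae_restrict_of_ae hpt)]
    rw [hcongr]
    have h1 := setLAverage_le_const_mul (C := A ^ (α * (1 / (t - 1)))) (a := a) (r := ρ)
      (f := fun x => twoPowerWeight α (α * (t - 1)) e x ^ (1 - t.conjExponent))
      (g := fun x => ‖x - e‖₊ ^ (-α)) (M := K * B ^ (-α)) ?_ hBavg
    · refine (ENNReal.rpow_le_rpow h1 hc3).trans (le_of_eq ?_)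
      rw [← ENNReal.coe_rpow_of_nonneg _ hc3]
      congr 1
      rw [NNReal.mul_rpow, NNReal.mul_rpow, ← NNReal.rpow_mul, ← NNReal.rpow_mul, hc2,
        show α * (1 / (t - 1)) * (1 - 1 / t) = α * (1 / t) by field_simp]
      ring
    · refine Filter.Eventually.of_forall fun x hxa => ?_
      rw [twoPowerWeight, NNReal.mul_rpow, ← NNReal.rpow_mul, ← NNReal.rpow_mul, hc1,
        show α * (t - 1) * -(1 / (t - 1)) = -α by field_simp,
        show -α * -(1 / (t - 1)) = α * (1 / (t - 1)) by ring]
      gcongr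
      exact hA x hxa
  refine (mul_le_mul' hjoint (Finset.prod_le_prod' fun j _ => hdual j)).trans (le_of_eq ?_)
  rw [← ENNReal.ofNNReal_finsetProd, ← ENNReal.coe_mul]
  congr 1
  rw [Finset.prod_mul_distrib, Finset.prod_mul_distrib, NNReal.prod_rpow_eq_rpow_sum hA0,
    NNReal.prod_rpow_eq_rpow_sum hB0, ← Finset.mul_sum, ← Finset.mul_sum, ← hrsum,
    Finset.sum_sub_distrib, ← hrsum, hS]
  -- All dependence on the cube cancels: `A` has total exponent `-α/r + ∑ α/Tⱼ = 0`, and `B` has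
  -- `γ/r - α(l - 1/r) = 0`.
  have h1 : A ^ (-α * (1 / r)) * A ^ (α * (1 / r)) = 1 := by
    rw [← NNReal.rpow_add hA0.ne']; simp
  have h2 : B ^ (γ * (1 / r)) * B ^ (-α * (∑ _j : Fin l, (1 : ℝ) - 1 / r)) = 1 := by
    rw [← NNReal.rpow_add hB0.ne']
    have : γ * (1 / r) + -α * (∑ _j : Fin l, (1 : ℝ) - 1 / r) = 0 := by
      rw [hγ]; simp; field_simp; ring
    rw [this, NNReal.rpow_zero]
  calc _ = K ^ (1 / r) * (∏ j, K ^ (1 / (T j).conjExponent)) *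
        (A ^ (-α * (1 / r)) * A ^ (α * (1 / r))) *
        (B ^ (γ * (1 / r)) * B ^ (-α * (∑ _j : Fin l, (1 : ℝ) - 1 / r))) := by ring
    _ = _ := by rw [h1, h2, mul_one, mul_one]

/-! ### Test functions and upper bounds for their weighted norms -/

/-- Schwartz functions `f_N(x) = Nⁿ g(N (x - e))` with Fourier transform
`e^{-2πi⟨e, ξ⟩} h(ξ / N)`. -/
lemma exists_schwartz_dilation {n : ℕ} {h : Rn n → ℂ} (hc : HasCompactSupport h)
    (hd : ContDiff ℝ (⊤ : ℕ∞) h) (e : Rn n) :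
    ∃ g : 𝓢(Rn n, ℂ), ∀ N : ℝ, 0 < N → ∃ f : 𝓢(Rn n, ℂ),
      (∀ ξ, (𝓕 f : 𝓢(Rn n, ℂ)) ξ =
        Complex.exp (2 * Real.pi * Complex.I * (inner ℝ (-e) ξ : ℝ)) * h (N⁻¹ • ξ)) ∧
      ∀ x, f x = (N : ℂ) ^ n * g (N • (x - e)) := by
  refine ⟨𝓕⁻ (hc.toSchwartzMap hd), fun N hN => ?_⟩
  have hc' : HasCompactSupport fun ξ : Rn n =>
      Complex.exp (2 * Real.pi * Complex.I * (inner ℝ (-e) ξ : ℝ)) * h (N⁻¹ • ξ) :=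
    (hc.comp_homeomorph (Homeomorph.smulOfNeZero N⁻¹ (inv_pos.mpr hN).ne')).mul_left
  have hd' : ContDiff ℝ (⊤ : ℕ∞) fun ξ : Rn n =>
      Complex.exp (2 * Real.pi * Complex.I * (inner ℝ (-e) ξ : ℝ)) * h (N⁻¹ • ξ) :=
    (contDiff_exp_inner _).mul (hd.comp (contDiff_const_smul _))
  refine ⟨𝓕⁻ (hc'.toSchwartzMap hd'), fun ξ => ?_, fun x => ?_⟩
  · rw [FourierTransform.fourier_fourierInv_eq]
    rfl
  · rw [SchwartzMap.fourierInv_coe, SchwartzMap.fourierInv_coe, Real.fourierInv_eq',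
      Real.fourierInv_eq']
    have hs := Measure.integral_comp_inv_smul (volume : Measure (Rn n)) (fun v : Rn n =>
      Complex.exp (↑(2 * Real.pi * inner ℝ v (N • (x - e))) * Complex.I) • h v) N
    rw [finrank_euclideanSpace_fin, abs_of_pos (by positivity), Complex.real_smul,
      Complex.ofReal_pow] at hs
    refine Eq.trans (integral_congr_ae (.of_forall fun ξ => ?_)) hs
    change Complex.exp (↑(2 * Real.pi * inner ℝ ξ x) * Complex.I) •
      (Complex.exp (2 * Real.pi * Complex.I * (inner ℝ (-e) ξ : ℝ)) * h (N⁻¹ • ξ)) = _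
    simp only [smul_eq_mul]
    rw [← mul_assoc, ← Complex.exp_add, inner_smul_left, inner_smul_right, inner_sub_right,
      inner_neg_left, real_inner_comm ξ e]
    congr 2
    have : (N : ℂ) ≠ 0 := by exact_mod_cast hN.ne'
    simp only [conj_trivial]
    push_cast
    field_simp
    ring

/-- The bump lives at distance about `1/N` from `e`, where `|x - e|^β` is about `N^{-β}`, on a
volume of order `N^{-n}`. The singularity `|x|^{-α}` at `0` meets only the Schwartz tail. -/
lemma exists_lintegral_dilation_le {n : ℕ} (g : 𝓢(Rn n, ℂ)) {α β P : ℝ} (hα : 0 < α)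
    (hn : α < n) (hβ : 0 ≤ β) (hP : 0 < P) {e : Rn n} (he : ‖e‖ = 1) :
    ∃ C : ℝ, 0 ≤ C ∧ ∀ N : ℝ, 1 ≤ N →
      ∫⁻ x, ‖g (N • (x - e))‖ₑ ^ P * (twoPowerWeight α β e x : ℝ≥0∞) ≤
        ENNReal.ofReal (C * N ^ (-((n : ℝ) + β))) := by
  -- Any `κ > n` would do: it makes the tail integrable and at most `N^{-n}` up to a constant near
  -- `0`. The additional decay `β` absorbs the growth of `|x - e|^β`.
  set κ : ℝ := n + 1 with hκ
  have hκ0 : 0 < κ := by positivity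
  obtain ⟨C, hC, hg⟩ := g.exists_norm_le_one_add_rpow ((κ + β) / P)
  obtain ⟨K₁, hK₁⟩ := exists_lintegral_ball_rpow_le (n := n) hα hn
  set K : ℝ≥0 := K₁ * (1 / 2) ^ ((n : ℝ) - α) with hK
  have hKint := hK₁ 0 (1 / 2) (by positivity)
  rw [← hK] at hKint
  have hJ : ∫⁻ x : Rn n, ENNReal.ofReal ((1 + ‖x‖) ^ (-κ)) < ⊤ :=
    finite_integral_one_add_norm (by rw [finrank_euclideanSpace_fin, hκ]; linarith)
  set J := ∫⁻ x : Rn n, ENNReal.ofReal ((1 + ‖x‖) ^ (-κ)) with hJdef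
  refine ⟨C ^ P * (2 ^ κ * K + 2 ^ α * J.toReal), by positivity, fun N hN => ?_⟩
  have hN0 : 0 < N := by linarith
  have hpt : ∀ x : Rn n, ‖g (N • (x - e))‖ₑ ^ P * (twoPowerWeight α β e x : ℝ≥0∞) ≤
      ENNReal.ofReal (C ^ P * N ^ (-β)) * (ENNReal.ofReal (2 ^ κ * N ^ (-(n : ℝ))) *
        (Metric.closedBall (0 : Rn n) ((1 / 2 : ℝ≥0) : ℝ)).indicator
          (fun x => ((‖x - 0‖₊ ^ (-α) : ℝ≥0) : ℝ≥0∞)) x +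
        ENNReal.ofReal (2 ^ α) * ENNReal.ofReal ((1 + ‖N • (x - e)‖) ^ (-κ))) := by
    intro x
    set ρ := ‖x - e‖ with hρ
    have hρ0 : 0 ≤ ρ := norm_nonneg _
    have hNρ : ‖N • (x - e)‖ = N * ρ := by rw [norm_smul, Real.norm_of_nonneg hN0.le]
    have hg1 : ‖g (N • (x - e))‖ ^ P ≤ C ^ P * (1 + N * ρ) ^ (-(κ + β)) := by
      have := hg (N • (x - e))
      rw [hNρ] at this
      calc _ ≤ (C * (1 + N * ρ) ^ (-((κ + β) / P))) ^ P :=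
            Real.rpow_le_rpow (norm_nonneg _) this hP.le
        _ = _ := by
            rw [Real.mul_rpow hC.le (by positivity), ← Real.rpow_mul (by positivity)]
            congr 2; field_simp
    have hg2 : (1 + N * ρ) ^ (-(κ + β)) * ρ ^ β ≤ N ^ (-β) * (1 + N * ρ) ^ (-κ) := by
      have h1 : (N * ρ) ^ β ≤ (1 + N * ρ) ^ β :=
        Real.rpow_le_rpow (by positivity) (by linarith) hβ
      calc (1 + N * ρ) ^ (-(κ + β)) * ρ ^ β =
            N ^ (-β) * ((1 + N * ρ) ^ (-(κ + β)) * (N * ρ) ^ β) := by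
              rw [Real.mul_rpow hN0.le hρ0, Real.rpow_neg hN0.le]; field_simp
        _ ≤ N ^ (-β) * ((1 + N * ρ) ^ (-(κ + β)) * (1 + N * ρ) ^ β) := by gcongr
        _ = _ := by rw [← Real.rpow_add (by positivity)]; congr 2; ring
    have hg3 : ‖x‖ ^ (-α) * (1 + N * ρ) ^ (-κ) ≤
        2 ^ κ * N ^ (-(n : ℝ)) * (Metric.closedBall (0 : Rn n) ((1 / 2 : ℝ≥0) : ℝ)).indicator
          (fun x => ‖x‖ ^ (-α)) x + 2 ^ α * (1 + N * ρ) ^ (-κ) := by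
      by_cases hx : x ∈ Metric.closedBall (0 : Rn n) ((1 / 2 : ℝ≥0) : ℝ)
      · rw [Set.indicator_of_mem hx]
        rw [mem_closedBall_zero_iff] at hx
        have hx' : ‖x‖ ≤ 1 / 2 := by simpa using hx
        have hρ1 : 1 / 2 ≤ ρ := by
          have : ‖e‖ ≤ ‖x‖ + ‖x - e‖ := by
            calc ‖e‖ = ‖x - (x - e)‖ := by congr 1; abel
              _ ≤ _ := norm_sub_le _ _
          rw [he] at this
          linarith
        have h1 : (1 + N * ρ) ^ (-κ) ≤ 2 ^ κ * N ^ (-(n : ℝ)) := by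
          calc (1 + N * ρ) ^ (-κ) ≤ (N / 2) ^ (-κ) :=
                Real.rpow_le_rpow_of_nonpos (by positivity) (by nlinarith) (by linarith)
            _ = 2 ^ κ * N ^ (-κ) := by
                rw [Real.div_rpow hN0.le (by norm_num), Real.rpow_neg (by norm_num : (0:ℝ) ≤ 2),
                  div_inv_eq_mul, mul_comm]
            _ ≤ 2 ^ κ * N ^ (-(n : ℝ)) := by
                gcongr
                rw [hκ]; linarith
        have h2 : 0 ≤ 2 ^ α * (1 + N * ρ) ^ (-κ) := by positivity
        have h3 : 0 ≤ ‖x‖ ^ (-α) := by positivity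
        nlinarith [mul_le_mul_of_nonneg_left h1 h3]
      · rw [Set.indicator_of_notMem hx, mul_zero, zero_add]
        have hx' : 1 / 2 ≤ ‖x‖ := by
          rw [mem_closedBall_zero_iff, not_le] at hx
          have : (((1 / 2 : ℝ≥0)) : ℝ) = 1 / 2 := by simp
          linarith
        gcongr
        calc ‖x‖ ^ (-α) ≤ (1 / 2) ^ (-α) :=
              Real.rpow_le_rpow_of_nonpos (by norm_num) hx' (by linarith)
          _ = 2 ^ α := by
              rw [one_div, Real.inv_rpow (by norm_num), Real.rpow_neg (by norm_num), inv_inv]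
    have hind : (Metric.closedBall (0 : Rn n) ((1 / 2 : ℝ≥0) : ℝ)).indicator
          (fun x => ((‖x - 0‖₊ ^ (-α) : ℝ≥0) : ℝ≥0∞)) x =
        ENNReal.ofReal ((Metric.closedBall (0 : Rn n) ((1 / 2 : ℝ≥0) : ℝ)).indicator
          (fun x => ‖x‖ ^ (-α)) x) := by
      by_cases hx : x ∈ Metric.closedBall (0 : Rn n) ((1 / 2 : ℝ≥0) : ℝ)
      · rw [Set.indicator_of_mem hx, Set.indicator_of_mem hx, sub_zero, ← coe_nnnorm,
          ← NNReal.coe_rpow, ENNReal.ofReal_coe_nnreal]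
      · rw [Set.indicator_of_notMem hx, Set.indicator_of_notMem hx, ENNReal.ofReal_zero]
    have hind0 : 0 ≤ (Metric.closedBall (0 : Rn n) ((1 / 2 : ℝ≥0) : ℝ)).indicator
          (fun x => ‖x‖ ^ (-α)) x := Set.indicator_nonneg (fun _ _ => by positivity) _
    rw [hind, ← ofReal_norm, ENNReal.ofReal_rpow_of_nonneg (norm_nonneg _) hP.le,
      ← ENNReal.ofReal_coe_nnreal, ← ENNReal.ofReal_mul (by positivity),
      ← ENNReal.ofReal_mul (by positivity), ← ENNReal.ofReal_mul (by positivity),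
      ← ENNReal.ofReal_add (by positivity) (by positivity), ← ENNReal.ofReal_mul (by positivity)]
    refine ENNReal.ofReal_le_ofReal ?_
    rw [twoPowerWeight, NNReal.coe_mul, NNReal.coe_rpow, NNReal.coe_rpow, coe_nnnorm, coe_nnnorm,
      hNρ, ← hρ]
    calc _ ≤ C ^ P * (1 + N * ρ) ^ (-(κ + β)) * (‖x‖ ^ (-α) * ρ ^ β) := by gcongr
      _ = C ^ P * ‖x‖ ^ (-α) * ((1 + N * ρ) ^ (-(κ + β)) * ρ ^ β) := by ring
      _ ≤ C ^ P * ‖x‖ ^ (-α) * (N ^ (-β) * (1 + N * ρ) ^ (-κ)) := by gcongr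
      _ = C ^ P * N ^ (-β) * (‖x‖ ^ (-α) * (1 + N * ρ) ^ (-κ)) := by ring
      _ ≤ _ := by gcongr
  refine (lintegral_mono hpt).trans ?_
  rw [lintegral_const_mul' _ _ ENNReal.ofReal_ne_top, lintegral_add_right _ (by fun_prop),
    lintegral_const_mul' _ _ ENNReal.ofReal_ne_top, lintegral_const_mul' _ _ ENNReal.ofReal_ne_top,
    lintegral_indicator Metric.isClosed_closedBall.measurableSet,
    lintegral_comp_smul_sub (fun y : Rn n => ENNReal.ofReal ((1 + ‖y‖) ^ (-κ))) e hN0, ← hJdef]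
  have hJ' : J = ENNReal.ofReal J.toReal := (ENNReal.ofReal_toReal hJ.ne).symm
  calc _ ≤ ENNReal.ofReal (C ^ P * N ^ (-β)) * (ENNReal.ofReal (2 ^ κ * N ^ (-(n : ℝ))) *
        ENNReal.ofReal K + ENNReal.ofReal (2 ^ α) * (ENNReal.ofReal (N ^ n)⁻¹ *
          ENNReal.ofReal J.toReal)) := by
        rw [← hJ', ENNReal.ofReal_coe_nnreal]
        gcongr
    _ = ENNReal.ofReal ((C ^ P * N ^ (-β)) * ((2 ^ κ * N ^ (-(n : ℝ))) * K +
          2 ^ α * ((N ^ n)⁻¹ * J.toReal))) := by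
        rw [← ENNReal.ofReal_mul (by positivity), ← ENNReal.ofReal_mul (by positivity),
          ← ENNReal.ofReal_mul (by positivity), ← ENNReal.ofReal_add (by positivity)
          (by positivity), ← ENNReal.ofReal_mul (by positivity)]
    _ = _ := by
        congr 1
        rw [neg_add, Real.rpow_add hN0, Real.rpow_neg hN0.le (n : ℝ), Real.rpow_natCast]
        ring

/-! ### Lower bounds for the output of the operator -/

lemma finrank_RnPow (n l : ℕ) : Module.finrank ℝ (RnPow n l) = n * l := by
  rw [LinearEquiv.finrank_eq (WithLp.linearEquiv 2 ℝ (Fin l → Rn n)), Module.finrank_pi_fintype]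
  simp [mul_comm]

/-- A multilinear Fourier integral with oscillation along the diagonal, continuous at the origin
where it does not vanish. -/
lemma exists_le_norm_diagonal_integral {n l : ℕ} {m : RnPow n l → ℝ} (hm : Continuous m)
    (hmc : HasCompactSupport m) (hm0 : ∀ ξ, 0 ≤ m ξ) {ξ₀ : RnPow n l} (hξ₀ : m ξ₀ ≠ 0) :
    ∃ c δ : ℝ, 0 < c ∧ 0 < δ ∧ δ ≤ 1 / 2 ∧ ∀ y : Rn n, ‖y‖ ≤ δ →
      c ≤ ‖∫ ξ, (m ξ : ℂ) * Complex.exp (2 * Real.pi * Complex.I *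
        (inner ℝ y (∑ j, ξ j) : ℝ))‖ := by
  have hcont : Continuous fun y : Rn n => ‖∫ ξ, (m ξ : ℂ) * Complex.exp (2 * Real.pi *
      Complex.I * (inner ℝ y (∑ j, ξ j) : ℝ))‖ := by
    refine (continuous_of_dominated (bound := m) (fun y => ?_) (fun y => ?_)
      (hm.integrable_of_hasCompactSupport hmc) (.of_forall fun ξ => ?_)).norm
    · exact (Continuous.aestronglyMeasurable (by fun_prop))
    · refine .of_forall fun ξ => ?_
      rw [norm_mul, Complex.norm_real, Real.norm_of_nonneg (hm0 ξ),
        show (2 * Real.pi * Complex.I * (inner ℝ y (∑ j, ξ j) : ℝ) : ℂ) =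
          ((2 * Real.pi * inner ℝ y (∑ j, ξ j) : ℝ) : ℂ) * Complex.I by push_cast; ring,
        Complex.norm_exp_ofReal_mul_I, mul_one]
    · fun_prop
  have hpos : 0 < ∫ ξ, m ξ :=
    hm.integral_pos_of_hasCompactSupport_nonneg_nonzero hmc hm0 hξ₀
  have h0 : ‖∫ ξ, (m ξ : ℂ) * Complex.exp (2 * Real.pi * Complex.I *
      (inner ℝ (0 : Rn n) (∑ j, ξ j) : ℝ))‖ = ∫ ξ, m ξ := by
    simp only [inner_zero_left, Complex.ofReal_zero, mul_zero, Complex.exp_zero, mul_one]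
    rw [integral_complex_ofReal, Complex.norm_real, Real.norm_of_nonneg hpos.le]
  have hev := (hcont.tendsto 0).eventually
    (lt_mem_nhds (a := (∫ ξ, m ξ) / 2) (by rw [h0]; linarith))
  obtain ⟨δ, hδ, hball⟩ := Metric.nhds_basis_closedBall.eventually_iff.mp hev
  refine ⟨(∫ ξ, m ξ) / 2, min δ (1 / 2), by linarith, by positivity, min_le_right _ _,
    fun y hy => (hball ?_).le⟩
  rw [mem_closedBall_zero_iff]
  exact hy.trans (min_le_left _ _)

lemma norm_apply_le_norm {n l : ℕ} (ξ : RnPow n l) (j : Fin l) : ‖ξ j‖ ≤ ‖ξ‖ :=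
  PiLp.norm_apply_le ξ j

/-- The test symbol `|ξ|^{-s} ∏ⱼ h(ξⱼ)` with `h` a bump at `e`. -/
lemma exists_le_norm_diagonal_integral_bump {n l : ℕ} (hl : 0 < l) (s : ℝ) {e : Rn n}
    (he : ‖e‖ = 1) (h : ContDiffBump e) (hh : h.rOut = 1 / 2) :
    ∃ c δ : ℝ, 0 < c ∧ 0 < δ ∧ δ ≤ 1 / 2 ∧ ∀ y : Rn n, ‖y‖ ≤ δ →
      c ≤ ‖∫ ξ : RnPow n l, ((‖ξ‖ ^ (-s) : ℝ) : ℂ) * (∏ j, (h (ξ j) : ℂ)) *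
        Complex.exp (2 * Real.pi * Complex.I * (inner ℝ y (∑ j, ξ j) : ℝ))‖ := by
  have hsupp : ∀ ξ : RnPow n l, (∏ j, (h (ξ j) : ℂ)) ≠ 0 → ∀ j, ‖ξ j - e‖ < 1 / 2 := by
    intro ξ hξ j
    have h1 := Finset.prod_ne_zero_iff.mp hξ j (Finset.mem_univ j)
    have h2 : ξ j ∈ Function.support h := fun h3 => h1 (by simp [h3])
    rwa [h.support_eq, hh, mem_ball_iff_norm] at h2
  have hlow : ∀ ξ : RnPow n l, (∏ j, (h (ξ j) : ℂ)) ≠ 0 → 1 / 2 ≤ ‖ξ‖ := by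
    intro ξ hξ
    have h1 := hsupp ξ hξ ⟨0, hl⟩
    have h2 : ‖e‖ ≤ ‖ξ ⟨0, hl⟩‖ + ‖ξ ⟨0, hl⟩ - e‖ := by
      calc ‖e‖ = ‖ξ ⟨0, hl⟩ - (ξ ⟨0, hl⟩ - e)‖ := by congr 1; abel
        _ ≤ _ := norm_sub_le _ _
    have h3 := norm_apply_le_norm ξ ⟨0, hl⟩
    rw [he] at h2
    linarith
  have hsmooth : ContDiff ℝ (⊤ : ℕ∞) fun ξ : RnPow n l => ∏ j, (h (ξ j) : ℂ) := by
    refine contDiff_prod fun j _ => ?_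
    exact Complex.ofRealCLM.contDiff.comp (h.contDiff.comp (by fun_prop))
  -- The bumps keep every block `ξⱼ` at distance at least `1/2` from `0`, so the singularity of
  -- `|ξ|^{-s}` is never met.
  have h0 : (0 : RnPow n l) ∉ tsupport fun ξ : RnPow n l => ∏ j, (h (ξ j) : ℂ) := by
    intro hmem
    have hcl : IsClosed {ξ : RnPow n l | 1 / 2 ≤ ‖ξ‖} := isClosed_le continuous_const continuous_norm
    have : (1 : ℝ) / 2 ≤ ‖(0 : RnPow n l)‖ := closure_minimal (fun ξ hξ => hlow ξ hξ) hcl hmem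
    rw [norm_zero] at this
    linarith
  have hcompact : HasCompactSupport fun ξ : RnPow n l => ∏ j, (h (ξ j) : ℂ) := by
    refine HasCompactSupport.of_support_subset_isCompact
      (isCompact_closedBall 0 (√(l * 4))) fun ξ hξ => ?_
    rw [mem_closedBall_zero_iff, PiLp.norm_eq_of_L2]
    refine Real.sqrt_le_sqrt ?_
    calc ∑ j, ‖ξ j‖ ^ 2 ≤ ∑ _j : Fin l, (4 : ℝ) := by
          refine Finset.sum_le_sum fun j _ => ?_
          have h1 := hsupp ξ hξ j
          have h2 : ‖ξ j‖ ≤ ‖ξ j - e‖ + ‖e‖ := by simpa using norm_add_le (ξ j - e) e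
          nlinarith [norm_nonneg (ξ j)]
      _ = l * 4 := by simp
  have hc := (contDiff_norm_rpow_mul (-s) hsmooth h0).continuous
  have hm : (fun ξ : RnPow n l => ‖ξ‖ ^ (-s) * ∏ j, h (ξ j)) =
      fun ξ => (((‖ξ‖ ^ (-s) : ℝ) : ℂ) * ∏ j, (h (ξ j) : ℂ)).re := by
    funext ξ
    rw [← Complex.ofReal_prod, ← Complex.ofReal_mul, Complex.ofReal_re]
  have hmc : Continuous fun ξ : RnPow n l => ‖ξ‖ ^ (-s) * ∏ j, h (ξ j) := by
    rw [hm]; exact Complex.continuous_re.comp hc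
  have hms : HasCompactSupport fun ξ : RnPow n l => ‖ξ‖ ^ (-s) * ∏ j, h (ξ j) := by
    rw [hm]; exact (hcompact.mul_left).comp_left Complex.zero_re
  have hval : ‖(WithLp.toLp 2 fun _ : Fin l => e : RnPow n l)‖ ^ (-s) *
      ∏ j, h ((WithLp.toLp 2 fun _ : Fin l => e : RnPow n l) j) ≠ 0 := by
    have h1 : (0 : ℝ) < ‖(WithLp.toLp 2 fun _ : Fin l => e : RnPow n l)‖ := by
      have := norm_apply_le_norm (WithLp.toLp 2 fun _ : Fin l => e : RnPow n l) ⟨0, hl⟩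
      simp only [he] at this
      linarith
    have h2 : h e = 1 := h.one_of_mem_closedBall (by simp [h.rIn_pos.le])
    simp only [h2, Finset.prod_const_one, mul_one]
    positivity
  obtain ⟨c, δ, hc0, hδ, hδ2, hbd⟩ := exists_le_norm_diagonal_integral hmc hms
    (fun ξ => mul_nonneg (by positivity) (Finset.prod_nonneg fun j _ => h.nonneg)) hval
  refine ⟨c, δ, hc0, hδ, hδ2, fun y hy => ?_⟩
  convert hbd y hy using 5 with ξ
  push_cast
  rfl

/-- On modulated dilated bumps the operator with the oscillating symbol is a dilation of the
diagonal integral. -/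
lemma multiplierOp_oscillatingSymbol_eq {n l : ℕ} (hl : 0 < l) (s : ℝ) {θ : RnPow n l → ℝ}
    (hθ1 : ∀ ξ, 2 ≤ ‖ξ‖ → θ ξ = 1) {e : Rn n} (he : ‖e‖ = 1) (h : ContDiffBump e)
    (hh : h.rOut = 1 / 2) {N : ℝ} (hN : 4 ≤ N) {f : 𝓢(Rn n, ℂ)}
    (hf : ∀ ξ, (𝓕 f : 𝓢(Rn n, ℂ)) ξ = Complex.exp (2 * Real.pi * Complex.I *
      (inner ℝ (-e) ξ : ℝ)) * (h (N⁻¹ • ξ) : ℂ)) (x : Rn n) :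
    multiplierOp (oscillatingSymbol θ s (WithLp.toLp 2 fun _ : Fin l => e)) (fun _ => f) x =
      ((N ^ ((n * l : ℝ) - s) : ℝ) : ℂ) * ∫ ξ : RnPow n l, ((‖ξ‖ ^ (-s) : ℝ) : ℂ) *
        (∏ j, (h (ξ j) : ℂ)) *
        Complex.exp (2 * Real.pi * Complex.I * (inner ℝ (N • x) (∑ j, ξ j) : ℝ)) := by
  have hN0 : 0 < N := by linarith
  have hs := Measure.integral_comp_inv_smul (volume : Measure (RnPow n l)) (fun ξ : RnPow n l =>
    ((N ^ (-s) : ℝ) : ℂ) * (((‖ξ‖ ^ (-s) : ℝ) : ℂ) * (∏ j, (h (ξ j) : ℂ)) *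
      Complex.exp (2 * Real.pi * Complex.I * (inner ℝ (N • x) (∑ j, ξ j) : ℝ)))) N
  rw [finrank_RnPow, abs_of_pos (by positivity)] at hs
  conv_rhs at hs =>
    rw [integral_const_mul, Complex.real_smul, ← mul_assoc, ← Complex.ofReal_mul,
      ← Real.rpow_natCast, ← Real.rpow_add hN0]
  rw [show (n * l : ℝ) - s = ((n * l : ℕ) : ℝ) + -s by push_cast; ring, ← hs, multiplierOp]
  refine integral_congr_ae (.of_forall fun ξ => ?_)
  simp only [oscillatingSymbol, hf]
  rw [Finset.prod_mul_distrib, ← Complex.exp_sum, ← Finset.mul_sum]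
  have hphase : (∑ j, ((inner ℝ (-e) (ξ j) : ℝ) : ℂ)) =
      -((inner ℝ (WithLp.toLp 2 fun _ : Fin l => e : RnPow n l) ξ : ℝ) : ℂ) := by
    rw [PiLp.inner_apply]
    push_cast
    rw [← Finset.sum_neg_distrib]
    exact Finset.sum_congr rfl fun j _ => by rw [inner_neg_left]; push_cast; rfl
  have hinner : inner ℝ (N • x) (∑ j, (N⁻¹ • ξ) j) = inner ℝ x (∑ j, ξ j) := by
    have : ∑ j, (N⁻¹ • ξ) j = N⁻¹ • ∑ j, ξ j := by rw [Finset.smul_sum]; rfl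
    rw [this, inner_smul_left, inner_smul_right]
    simp only [conj_trivial]
    field_simp
  have hnorm : N ^ (-s) * ‖N⁻¹ • ξ‖ ^ (-s) = ‖ξ‖ ^ (-s) := by
    rw [← Real.mul_rpow hN0.le (norm_nonneg _), norm_smul, norm_inv, Real.norm_of_nonneg hN0.le,
      mul_inv_cancel_left₀ hN0.ne']
  -- On the support, `|ξ| ≥ N/2 ≥ 2`, so the cutoff is invisible. This is where `N ≥ 4` enters.
  have hθ : (θ ξ : ℂ) * (∏ j, (h (N⁻¹ • ξ j) : ℂ)) = ∏ j, (h (N⁻¹ • ξ j) : ℂ) := by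
    by_cases hz : (∏ j, (h (N⁻¹ • ξ j) : ℂ)) = 0
    · rw [hz, mul_zero]
    · have h1 := Finset.prod_ne_zero_iff.mp hz ⟨0, hl⟩ (Finset.mem_univ _)
      have h2 : N⁻¹ • ξ ⟨0, hl⟩ ∈ Function.support h := fun h3 => h1 (by simp [h3])
      rw [h.support_eq, hh, mem_ball_iff_norm] at h2
      have h3 : ‖e‖ ≤ ‖N⁻¹ • ξ ⟨0, hl⟩‖ + ‖N⁻¹ • ξ ⟨0, hl⟩ - e‖ := by
        calc ‖e‖ = ‖N⁻¹ • ξ ⟨0, hl⟩ - (N⁻¹ • ξ ⟨0, hl⟩ - e)‖ := by congr 1; abel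
          _ ≤ _ := norm_sub_le _ _
      have h4 := norm_apply_le_norm ξ ⟨0, hl⟩
      rw [norm_smul, norm_inv, Real.norm_of_nonneg hN0.le, he] at h3
      have h5 : 1 / 2 ≤ N⁻¹ * ‖ξ ⟨0, hl⟩‖ := by linarith
      rw [inv_mul_eq_div, le_div_iff₀ hN0] at h5
      rw [hθ1 ξ (by linarith), Complex.ofReal_one, one_mul]
  rw [hphase, hinner, ← hnorm]
  -- The phase of the symbol undoes the modulations that centre the inputs at `e`; this moves the
  -- output to `0`.
  have hexp : Complex.exp (2 * Real.pi * Complex.I *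
      ((inner ℝ (WithLp.toLp 2 fun _ : Fin l => e : RnPow n l) ξ : ℝ) : ℂ)) *
      Complex.exp (2 * Real.pi * Complex.I *
      -((inner ℝ (WithLp.toLp 2 fun _ : Fin l => e : RnPow n l) ξ : ℝ) : ℂ)) = 1 := by
    rw [← Complex.exp_add, mul_neg, add_neg_cancel, Complex.exp_zero]
  have happ : ∀ j, (N⁻¹ • ξ) j = N⁻¹ • ξ j := fun j => rfl
  simp only [happ]
  set E₁ := Complex.exp (2 * Real.pi * Complex.I *
      ((inner ℝ (WithLp.toLp 2 fun _ : Fin l => e : RnPow n l) ξ : ℝ) : ℂ))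
  set E₂ := Complex.exp (2 * Real.pi * Complex.I *
      -((inner ℝ (WithLp.toLp 2 fun _ : Fin l => e : RnPow n l) ξ : ℝ) : ℂ))
  set F₁ := ∏ j, (h (N⁻¹ • ξ j) : ℂ)
  set E₃ := Complex.exp (2 * Real.pi * Complex.I * ((inner ℝ x (∑ j, ξ j) : ℝ) : ℂ))
  rw [Complex.ofReal_mul]
  calc _ = ((θ ξ : ℂ) * F₁) * ((N ^ (-s) : ℝ) : ℂ) * ((‖N⁻¹ • ξ‖ ^ (-s) : ℝ) : ℂ) * (E₁ * E₂) *
        E₃ := by ring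
    _ = _ := by rw [hexp, hθ]; ring

lemma exists_le_lintegral_twoPowerWeight {n : ℕ} (hn : 0 < n) {α γ p c δ : ℝ} (hα : 0 ≤ α)
    (hγ : 0 ≤ γ) (hp : 0 < p) (hc : 0 < c) (hδ : 0 < δ) (hδ2 : δ ≤ 1 / 2) {e : Rn n}
    (he : ‖e‖ = 1) :
    ∃ c₁ : ℝ, 0 < c₁ ∧ ∀ (N M : ℝ) (F : Rn n → ℂ), 1 ≤ N →
      (∀ x, ‖x‖ ≤ δ / N → c * N ^ M ≤ ‖F x‖) →
        ENNReal.ofReal (c₁ * N ^ (M * p + α - n)) ≤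
          ∫⁻ x, ‖F x‖ₑ ^ p * (twoPowerWeight α γ e x : ℝ≥0∞) := by
  have hV0 : 0 < volume (Metric.ball (0 : Rn n) 1) := Metric.measure_ball_pos _ _ one_pos
  have hVt : volume (Metric.ball (0 : Rn n) 1) ≠ ⊤ := measure_ball_lt_top.ne
  set V := (volume (Metric.ball (0 : Rn n) 1)).toReal with hV
  have hVpos : 0 < V := ENNReal.toReal_pos hV0.ne' hVt
  refine ⟨c ^ p * δ ^ (-α) * (1 / 2) ^ γ * δ ^ n * V, by positivity, fun N M F hN hF => ?_⟩
  have hN0 : 0 < N := by linarith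
  have hδN : 0 < δ / N := by positivity
  have hδN2 : δ / N ≤ 1 / 2 := (div_le_self hδ.le hN).trans hδ2
  have hpt : ∀ᵐ x : Rn n, x ∈ Metric.closedBall (0 : Rn n) (δ / N) →
      ENNReal.ofReal ((c * N ^ M) ^ p * ((δ / N) ^ (-α) * (1 / 2) ^ γ)) ≤
        ‖F x‖ₑ ^ p * (twoPowerWeight α γ e x : ℝ≥0∞) := by
    -- The origin is dropped because `0 ^ (-α)` is `0` for `α ≠ 0`, which would break the lower
    -- bound.
    filter_upwards [ae_ne_point hn 0] with x hx hxb
    rw [mem_closedBall_zero_iff] at hxb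
    rw [← ofReal_norm, ENNReal.ofReal_rpow_of_nonneg (norm_nonneg _) hp.le,
      ← ENNReal.ofReal_coe_nnreal, ← ENNReal.ofReal_mul (by positivity)]
    refine ENNReal.ofReal_le_ofReal ?_
    rw [twoPowerWeight, NNReal.coe_mul, NNReal.coe_rpow, NNReal.coe_rpow, coe_nnnorm, coe_nnnorm]
    have h1 : 1 / 2 ≤ ‖x - e‖ := by
      have : ‖e‖ ≤ ‖x‖ + ‖x - e‖ := by
        calc ‖e‖ = ‖x - (x - e)‖ := by congr 1; abel
          _ ≤ _ := norm_sub_le _ _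
      rw [he] at this
      linarith
    have h2 : (δ / N) ^ (-α) ≤ ‖x‖ ^ (-α) :=
      Real.rpow_le_rpow_of_nonpos (norm_pos_iff.mpr hx) hxb (by linarith)
    have h3 := hF x hxb
    gcongr
  calc _ = ENNReal.ofReal ((c * N ^ M) ^ p * ((δ / N) ^ (-α) * (1 / 2) ^ γ)) *
        volume (Metric.closedBall (0 : Rn n) (δ / N)) := by
        rw [Measure.addHaar_closedBall _ _ hδN.le, finrank_euclideanSpace_fin,
          ← ENNReal.ofReal_toReal hVt, ← hV, ← ENNReal.ofReal_mul (by positivity),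
          ← ENNReal.ofReal_mul (by positivity)]
        congr 1
        rw [Real.mul_rpow hc.le (by positivity), Real.div_rpow hδ.le hN0.le, div_pow,
          Real.rpow_sub hN0, Real.rpow_add hN0, Real.rpow_mul hN0.le, Real.rpow_natCast,
          Real.rpow_neg hN0.le, div_inv_eq_mul]
        field_simp
    _ = ∫⁻ _x in Metric.closedBall (0 : Rn n) (δ / N),
          ENNReal.ofReal ((c * N ^ M) ^ p * ((δ / N) ^ (-α) * (1 / 2) ^ γ)) :=
        (setLIntegral_const _ _).symm
    _ ≤ ∫⁻ x in Metric.closedBall (0 : Rn n) (δ / N),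
          ‖F x‖ₑ ^ p * (twoPowerWeight α γ e x : ℝ≥0∞) :=
        setLIntegral_mono_ae' Metric.isClosed_closedBall.measurableSet hpt
    _ ≤ _ := setLIntegral_le_lintegral _ _

lemma weightedNorm_dilation_le {n : ℕ} {P b C N : ℝ} (hP : 0 < P) (hC : 0 ≤ C) (hN : 0 < N)
    {w : Rn n → ℝ≥0} {g f : Rn n → ℂ} {e : Rn n} (hf : ∀ x, f x = (N : ℂ) ^ n * g (N • (x - e)))
    (hg : ∫⁻ x, ‖g (N • (x - e))‖ₑ ^ P * (w x : ℝ≥0∞) ≤ ENNReal.ofReal (C * N ^ b)) :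
    weightedNorm P w f ≤ ENNReal.ofReal (C ^ (1 / P) * N ^ (n + b / P)) := by
  have h1 : ∫⁻ x, ‖f x‖ₑ ^ P * (w x : ℝ≥0∞) =
      ENNReal.ofReal (N ^ (n * P)) * ∫⁻ x, ‖g (N • (x - e))‖ₑ ^ P * (w x : ℝ≥0∞) := by
    rw [← lintegral_const_mul' _ _ ENNReal.ofReal_ne_top]
    refine lintegral_congr fun x => ?_
    rw [hf, enorm_mul, ENNReal.mul_rpow_of_nonneg _ _ hP.le, mul_assoc]
    congr 1
    rw [← ofReal_norm, norm_pow, Complex.norm_real, Real.norm_of_nonneg hN.le,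
      ENNReal.ofReal_rpow_of_nonneg (by positivity) hP.le, ← Real.rpow_natCast,
      ← Real.rpow_mul hN.le]
  rw [weightedNorm, h1]
  calc _ ≤ (ENNReal.ofReal (N ^ (n * P)) * ENNReal.ofReal (C * N ^ b)) ^ (1 / P) := by gcongr
    _ = _ := by
      rw [← ENNReal.ofReal_mul (by positivity),
        ENNReal.ofReal_rpow_of_nonneg (by positivity) (by positivity)]
      congr 1
      rw [mul_left_comm, ← Real.rpow_add hN, Real.mul_rpow hC (by positivity),
        ← Real.rpow_mul hN.le]
      congr 2
      field_simp

/-! ### The contradiction as the bumps shrink -/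

theorem theorem1p1 (n l : ℕ) (s q p : ℝ) (P : Fin l → ℝ)
    (hs : (n * l : ℝ) / 2 < s) (hs' : s ≤ n * l) (hq : 0 < q)
    (hP : ∀ j, max q (n * l / s) ≤ P j) (hp : ∑ j, 1 / P j = 1 / p)
    (Ψ : 𝓢(RnPow n l, ℂ)) (hΨ : IsLittlewoodPaley Ψ)
    (hbound : ∀ σ : RnPow n l → ℂ, hormanderNorm Ψ s σ < ⊤ →
      ∀ w : Fin l → Rn n → ℝ≥0, IsMultiWeight (fun j => P j / q) w →
        ∃ C : ℝ≥0, ∀ f : Fin l → 𝓢(Rn n, ℂ),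
          weightedNorm p (jointWeight P w) (multiplierOp σ f) ≤
            C * hormanderNorm Ψ s σ * ∏ j, weightedNorm (P j) (w j) (f j)) :
    n * l / s ≤ q := by
  by_contra! hlt
  have hnl : 0 < n * l := by
    by_contra h0
    have h1 : n * l = 0 := by omega
    have h2 : (n * l : ℝ) = 0 := by exact_mod_cast h1
    rw [h2] at hs hs'
    linarith
  have hn : 0 < n := Nat.pos_of_mul_pos_right hnl
  have hl : 0 < l := Nat.pos_of_mul_pos_left hnl
  have hn' : (0 : ℝ) < n := by exact_mod_cast hn
  have hl' : (0 : ℝ) < l := by exact_mod_cast hl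
  have hs0 : 0 < s := lt_trans (by positivity) hs
  have : Nonempty (Fin l) := ⟨⟨0, hl⟩⟩
  -- Strictness makes every `Pⱼ/q > 1`, so the endpoint case of the weight condition never arises.
  have hPq : ∀ j, q < P j := fun j => hlt.trans_le ((le_max_right _ _).trans (hP j))
  have hP0 : ∀ j, 0 < P j := fun j => hq.trans (hPq j)
  have hp0 : 0 < p := by
    have h1 : 0 < ∑ j, 1 / P j :=
      Finset.sum_pos (fun j _ => one_div_pos.mpr (hP0 j)) Finset.univ_nonempty
    rw [hp] at h1
    exact one_div_pos.mp h1
  have hjP : jointExponent P = p := by rw [jointExponent, hp, one_div, inv_inv]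
  have hjT : jointExponent (fun j => P j / q) = p / q := by rw [jointExponent_div, hjP]
  -- an exponent `α < n` which is still large enough
  have hsq : s * q < n * l := by rwa [lt_div_iff₀ hs0, mul_comm] at hlt
  obtain ⟨α, hα1, hαn⟩ := exists_between (show s * q / l < n by rwa [div_lt_iff₀ hl'])
  have hα0 : 0 < α := lt_trans (by positivity) hα1
  have hε : 0 < α * l / q - s := by
    rw [sub_pos, lt_div_iff₀ hq]
    rwa [div_lt_iff₀ hl'] at hα1
  have hT1 : ∀ j, 1 < P j / q := fun j => (one_lt_div hq).mpr (hPq j)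
  set e : Rn n := EuclideanSpace.single ⟨0, hn⟩ 1 with he_def
  have he : ‖e‖ = 1 := by simp [he_def]
  set w : Fin l → Rn n → ℝ≥0 := fun j => twoPowerWeight α (α * (P j / q - 1)) e with hw
  have hmw : IsMultiWeight (fun j => P j / q) w := isMultiWeight_twoPowerWeight hl hT1 hα0 hαn e
  set γ : ℝ := α * (l * (p / q) - 1) with hγ
  have hjw : ∀ᵐ x, jointWeight P w x = twoPowerWeight α γ e x := by
    filter_upwards [ae_ne_point hn 0, ae_ne_point hn e] with x hx hxe
    rw [← jointWeight_div P hq.ne' w, hw, jointWeight_twoPowerWeight (by rw [hjT]; positivity)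
      (fun j => (one_pos.trans (hT1 j)).ne') α hx hxe, hjT]
  have hγ0 : 0 ≤ γ := by
    have h1 : 1 / p ≤ l * (1 / q) := by
      rw [← hp]
      calc ∑ j, 1 / P j ≤ ∑ _j : Fin l, 1 / q :=
            Finset.sum_le_sum fun j _ => one_div_le_one_div_of_le hq (hPq j).le
        _ = l * (1 / q) := by simp
    rw [div_le_iff₀ hp0] at h1
    refine mul_nonneg hα0.le ?_
    rw [sub_nonneg]
    calc 1 ≤ l * (1 / q) * p := h1
      _ = _ := by ring
  -- the symbol
  let χ : ContDiffBump (0 : RnPow n l) := ⟨1, 2, one_pos, one_lt_two⟩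
  set θ : RnPow n l → ℝ := fun ξ => 1 - χ ξ with hθ
  have hθ0 : ∀ ξ, ‖ξ‖ ≤ 1 → θ ξ = 0 := fun ξ hξ => by
    rw [hθ]
    simp only
    rw [χ.one_of_mem_closedBall (by rw [mem_closedBall_zero_iff]; exact hξ), sub_self]
  have hθ1 : ∀ ξ, 2 ≤ ‖ξ‖ → θ ξ = 1 := fun ξ hξ => by
    rw [hθ]
    simp only
    rw [χ.zero_of_le_dist (by rw [dist_zero_right]; exact hξ), sub_zero]
  set ē : RnPow n l := WithLp.toLp 2 fun _ => e
  set σ := oscillatingSymbol θ s ē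
  have hσ : hormanderNorm Ψ s σ < ⊤ :=
    hormanderNorm_oscillatingSymbol_lt_top hΨ hs0.le (contDiff_const.sub χ.contDiff) hθ0 hθ1 ē
  obtain ⟨C, hC⟩ := hbound σ hσ w hmw
  -- the test functions
  let h : ContDiffBump e := ⟨1 / 4, 1 / 2, by norm_num, by norm_num⟩
  obtain ⟨g, hg⟩ := exists_schwartz_dilation (h := fun ξ => (h ξ : ℂ))
    (h.hasCompactSupport.comp_left Complex.ofReal_zero)
    (Complex.ofRealCLM.contDiff.comp h.contDiff) e
  obtain ⟨c, δ, hc, hδ, hδ2, hG⟩ :=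
    exists_le_norm_diagonal_integral_bump (l := l) hl s he h rfl
  obtain ⟨c₁, hc₁, hlow⟩ :=
    exists_le_lintegral_twoPowerWeight hn hα0.le hγ0 hp0 hc hδ hδ2 he
  choose B hB0 hB using fun j => exists_lintegral_dilation_le g (P := P j)
    (β := α * (P j / q - 1)) hα0 hαn (mul_nonneg hα0.le (by linarith [hT1 j])) (hP0 j) he
  set D : ℝ := C * (hormanderNorm Ψ s σ).toReal * ∏ j, B j ^ (1 / P j) with hD
  have key : ∀ N : ℝ, 4 ≤ N → c₁ ^ (1 / p) * N ^ (α * l / q - s) ≤ D := by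
    intro N hN
    have hN0 : 0 < N := by linarith
    obtain ⟨f, hf1, hf2⟩ := hg N hN0
    have hTf := multiplierOp_oscillatingSymbol_eq (l := l) hl s hθ1 he h rfl hN hf1
    have h1 : ENNReal.ofReal (c₁ ^ (1 / p) * N ^ ((((n * l : ℝ) - s) * p + α - n) / p)) ≤
        weightedNorm p (jointWeight P w) (multiplierOp σ fun _ => f) := by
      have h2 := hlow N ((n * l : ℝ) - s) (multiplierOp σ fun _ => f) (by linarith) ?_
      · have h3 : ∫⁻ x, ‖multiplierOp σ (fun _ => f) x‖ₑ ^ p * (jointWeight P w x : ℝ≥0∞) =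
            ∫⁻ x, ‖multiplierOp σ (fun _ => f) x‖ₑ ^ p * (twoPowerWeight α γ e x : ℝ≥0∞) := by
          refine lintegral_congr_ae ?_
          filter_upwards [hjw] with x hx
          rw [hx]
        rw [weightedNorm, h3]
        refine le_trans (le_of_eq ?_) (ENNReal.rpow_le_rpow h2 (by positivity))
        rw [ENNReal.ofReal_rpow_of_nonneg (by positivity) (by positivity),
          Real.mul_rpow hc₁.le (by positivity), ← Real.rpow_mul hN0.le, mul_one_div]
      · intro x hx
        rw [hTf x, norm_mul, Complex.norm_real, Real.norm_of_nonneg (by positivity), mul_comm]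
        gcongr
        refine hG _ ?_
        rw [norm_smul, Real.norm_of_nonneg hN0.le]
        rwa [le_div_iff₀ hN0, mul_comm] at hx
    have h2 : ∀ j, weightedNorm (P j) (w j) f ≤ ENNReal.ofReal
        (B j ^ (1 / P j) * N ^ (n + -((n : ℝ) + α * (P j / q - 1)) / P j)) := fun j =>
      weightedNorm_dilation_le (hP0 j) (hB0 j) hN0 hf2 (hB j N (by linarith))
    have h3 := (h1.trans (hC fun _ => f)).trans
      (mul_le_mul_right (Finset.prod_le_prod' fun j _ => h2 j) _)
    rw [← ENNReal.ofReal_prod_of_nonneg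
      (fun j _ => mul_nonneg (Real.rpow_nonneg (hB0 j) _) (by positivity)),
      ← ENNReal.ofReal_toReal hσ.ne, ← ENNReal.ofReal_coe_nnreal,
      ← ENNReal.ofReal_mul (by positivity), ← ENNReal.ofReal_mul (by positivity),
      Finset.prod_mul_distrib, ← Real.rpow_sum_of_pos hN0, ← mul_assoc, ← hD,
      ENNReal.ofReal_le_ofReal_iff
        (mul_nonneg (mul_nonneg (by positivity) (Finset.prod_nonneg fun j _ =>
          Real.rpow_nonneg (hB0 j) _)) (by positivity))] at h3
    have hexp : ∑ j, ((n : ℝ) + -((n : ℝ) + α * (P j / q - 1)) / P j) =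
        n * l - n / p + α / p - α * l / q := by
      calc _ = ∑ j, (((n : ℝ) - α / q) + (α - n) * (1 / P j)) :=
            Finset.sum_congr rfl fun j _ => by
              have := (hP0 j).ne'
              field_simp
              ring
        _ = _ := by
            rw [Finset.sum_add_distrib, ← Finset.mul_sum, hp]
            simp
            ring
    -- The output exponent is the input exponent plus the gain `αl/q - s`; the common power of `N`
    -- then cancels.
    have hexp2 : (((n * l : ℝ) - s) * p + α - n) / p =
        (α * l / q - s) + (n * l - n / p + α / p - α * l / q) := by
      field_simp
      ring
    rw [hexp, hexp2, Real.rpow_add hN0, ← mul_assoc] at h3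
    exact le_of_mul_le_mul_right h3 (by positivity)
  have htend := (tendsto_rpow_atTop hε).const_mul_atTop (Real.rpow_pos_of_pos hc₁ (1 / p))
  obtain ⟨N, hN, hN4⟩ :=
    ((htend.eventually_gt_atTop D).and (Filter.eventually_ge_atTop 4)).exists
  exact absurd (key N hN4) (not_le.mpr hN)
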